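/- **Setting.** Consider a surface code (or, more generally, any code given by pairwise commuting plaquette Pauli operators) on finitely many data qubits; its stabilizers are the products of plaquette operators (up to phase), and a non-trivial logical error is a Pauli operator that commutes with all stabilizers and is not a stabilizer. A *graphical model* $(G_T,p,f,\pi)$ consists of a finite hypergraph $G_T=(V_T,E_T)$ whose vertices are measurement vertices $(a,t)\in V_\bullet$, for each measured plaquette $a$ and each round $t=1,\dots,T+1$ (the final round $T+1$ being perfect), and further boundary vertices; a fault probability $p_e\in[0,1]$ and a residual Pauli error $\pi_e$ for each $e\in E_T$; and a pair of probability densities $f^{(0)}_{a,t},f^{(1)}_{a,t}$ on $\mathbb R$ for each $a$ and each $t\le T$. A fault set is a set $x\subseteq E_T$, with residual error $\pi(x)=\prod_{e\in x}\pi_e$. Its ideal outcome $\overline m_{a,t}\in\mathbb Z_2$ is the number modulo 2 of pairs $(e,t')$ with $e\in x$, $t'\le t$, $(a,t')\in e$. For $t\le T$ a soft outcome $m_{a,t}\in\mathbb R$ is observed, with hard outcome $\hat m_{a,t}=0$ if $f^{(0)}_{a,t}(m_{a,t})\ge f^{(1)}_{a,t}(m_{a,t})$ and $1$ otherwise; in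 the perfect round $\hat m_{a,T+1}=\overline m_{a,T+1}$ is observed. The syndrome is $\hat s_{a,t}=\hat m_{a,t}+\hat m_{a,t-1}$, with $\hat m_{a,0}=0$. The *decoding graph* $\tilde G_T$ has the edges of $G_T$ and, for each $a$ and $t\le T$, one soft edge joining $(a,t)$ and $(a,t+1)$; all boundary vertices are identified to one ghost vertex. Weights in $[0,\infty]$ are $w(e)=-\log\frac{p_e}{1-p_e}$ for $e\in E_T$ and $w(e)=-\log\big(f^{(\hat m_{a,t}+1)}_{a,t}(m_{a,t})/f^{(\hat m_{a,t})}_{a,t}(m_{a,t})\big)$ for the soft edge at $(a,t)$ (with $-\log 0=\infty$; the weight is also $\infty$ if both densities vanish), and $|z|_w=\sum_{e\in z}w(e)$. For a fault set $x$, let $\tilde x$ be the union of $x$ and the soft edges at the $(a,t)$ with $\hat m_{a,t}\ne\overline m_{a,t}$. A chain (set of edges) of $\tilde G_T$ has trivial syndrome if each measurement vertex lies on an even number of its edges. Its weighted diameter $\mathrm{diam}_w$ is the maximal weighted distance between two vertices incident to it, along paths of hard and soft edges, where distinct boundary vertices are *not* identified. The weighted minimum distance $d_w$ is the minimum of $|x|_w$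 over all fault sets $x$ for which $\pi(x)$ is a non-trivial logical error ($\infty$ if there is none). Conditions: (C1) every edge of $G_T$ contains exactly two vertices; (C2) $p_e<1/2$ for all $e\in E_T$; (C3) for the weights $w$ given by the observed soft outcomes, if a chain $z$ of $\tilde G_T$ has trivial syndrome and $\mathrm{diam}_w(z)<d_w$, then $\pi(z\cap E_T)$ is a stabilizer. **Soft Union-Find decoder.** Let $\tilde H_T$ be the graph obtained from $\tilde G_T$ by adding a vertex in the middle of every edge $e$; both halves of $e$ get weight $w(e)/2$. Start with $\gamma=0$ on all edges of $\tilde H_T$. Clusters are the connected components formed by the fully grown edges ($\gamma=w$); a cluster is odd if it contains an odd number of vertices with $\hat s=1$ and not the ghost vertex. While there is an odd cluster, select an odd cluster $C$ whose set $B(C)$ of edges to its complement has minimum cardinality (in case of a tie, a least recently grown one; remaining ties are broken arbitrarily), and increase $\gamma$ on $B(C)$ by $\Gamma_C=\min_{e\in B(C)}(w(e)-\gamma(e))$. Then let $\varepsilon$ be the set of edges of $\tilde G_T$ both of whose halves are fully grown, and apply the peeling decoder: take any spanning forest of $\varepsilon$ and, until it is empty, remove a leaf edge whose pendant vertex is not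 the ghost vertex; whenever the current syndrome at the pendant vertex is $1$, add the edge to the correction and flip the syndrome at its end points. The output is the set $y\subseteq E_T$ of those edges of the correction that lie in $E_T$. **Theorem.** Consider a graphical model satisfying (C1) and (C2), and a set of soft outcomes for which (C3) holds. Then the soft Union-Find decoder corrects every fault set $x$ with $|\tilde x|_w<d_w/2$: given the outcomes, every run of the decoder terminates and returns a fault set $y$ such that the residual error $\pi(x)\pi(y)$ is a stabilizer. -/

import Mathlib

open scoped ENNReal

noncomputable section

namespace SoftUF

/-- Pauli operators on the qubits `Q`, up to phase: at each qubit the exponents of `X` and `Z`.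
Multiplication of Pauli operators is addition. -/
abbrev Pauli (Q : Type*) : Type _ := Q → ZMod 2 × ZMod 2

/-- The symplectic product; it is `0` iff the two Pauli operators commute. -/
def Pauli.symp {Q : Type*} [Fintype Q] (a b : Pauli Q) : ZMod 2 :=
  ∑ q, ((a q).1 * (b q).2 + (a q).2 * (b q).1)

/-- A code on the data qubits `Q` given by pairwise commuting plaquette operators, indexed by `P`
(for instance any surface code). -/
structure PlaquetteCode (Q P : Type*) [Fintype Q] where
  plaquette : P → Pauli Q
  commute : ∀ i j, Pauli.symp (plaquette i) (plaquette j) = 0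

/-- The stabilizers: the products of plaquette operators. -/
def PlaquetteCode.stabilizers {Q P : Type*} [Fintype Q] (code : PlaquetteCode Q P) :
    AddSubgroup (Pauli Q) :=
  AddSubgroup.closure (Set.range code.plaquette)

/-- A non-trivial logical error commutes with all plaquette operators but is no stabilizer. -/
def PlaquetteCode.IsNontrivialLogical {Q P : Type*} [Fintype Q] (code : PlaquetteCode Q P)
    (a : Pauli Q) : Prop :=
  (∀ i, Pauli.symp a (code.plaquette i) = 0) ∧ a ∉ code.stabilizers

/-- Measurement vertices `(a, t)`. The rounds `0, …, T - 1` are the `T` rounds of soft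
measurements, and the round `T` is the final round of perfect measurements. -/
abbrev MVertex (A : Type*) (T : ℕ) : Type _ := A × Fin (T + 1)

/-- Vertices of the fault hypergraph: measurement vertices and boundary vertices `B`. -/
abbrev Vertex (A B : Type*) (T : ℕ) : Type _ := MVertex A T ⊕ B

/-- A graphical model for `T` rounds of soft measurements (followed by a perfect round).
`A` labels the plaquettes which carry measurement vertices (all plaquettes of the code, or those
of one type only), `B` the boundary vertices and `E` the faults. -/
structure GraphicalModel {Q P : Type*} [Fintype Q] (code : PlaquetteCode Q P)
    (A B E : Type*) (T : ℕ) where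
  /-- the plaquette measured at `a` -/
  plaq : A ↪ P
  /-- the vertices of a hyperedge -/
  verts : E → Finset (Vertex A B T)
  /-- the fault probabilities -/
  prob : E → ℝ
  prob_nonneg : ∀ e, 0 ≤ prob e
  prob_le_one : ∀ e, prob e ≤ 1
  /-- `density a t i` is the probability density of the soft outcome of plaquette `a` in round `t`
  when the ideal outcome is `i` -/
  density : A → Fin T → ZMod 2 → ℝ → ℝ
  density_nonneg : ∀ a t i μ, 0 ≤ density a t i μ
  density_measurable : ∀ a t i, Measurable (density a t i)
  density_lintegral : ∀ a t i, ∫⁻ μ, ENNReal.ofReal (density a t i μ) = 1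
  /-- the residual errors on the data qubits -/
  residual : E → Pauli Q

/-- The data seen by the decoder: the soft outcomes of the `T` soft rounds and the outcome bits of
the perfect round. -/
structure Outcomes (A : Type*) (T : ℕ) where
  soft : A → Fin T → ℝ
  final : A → ZMod 2

namespace GraphicalModel

variable {Q P A B E : Type*} {T : ℕ} [Fintype Q] {code : PlaquetteCode Q P}

/-- (C1): all edges of the fault hypergraph have rank two. -/
def C1 (M : GraphicalModel code A B E T) : Prop := ∀ e, (M.verts e).card = 2

/-- (C2): all fault probabilities are less than `1 / 2`. -/
def C2 (M : GraphicalModel code A B E T) : Prop := ∀ e, M.prob e < 1 / 2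

/-- The residual error of a fault set. -/
def resid (M : GraphicalModel code A B E T) (x : Finset E) : Pauli Q := ∑ e ∈ x, M.residual e

/-! ### Outcomes and syndromes -/

section Outcomes

variable [DecidableEq A] [DecidableEq B]

/-- The ideal outcome of a fault set: a fault that contains `(a, t')` changes the ideal outcome at
`(a, t)` for all `t ≥ t'`. -/
def ideal (M : GraphicalModel code A B E T) (x : Finset E) (a : A) (t : Fin (T + 1)) : ZMod 2 :=
  ∑ e ∈ x, ∑ t' ∈ Finset.Iic t, if Sum.inl (a, t') ∈ M.verts e then 1 else 0

/-- The observed outcomes when the fault set is `x` and the soft outcomes are `μ`; the final round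
is perfect. -/
def outcomes (M : GraphicalModel code A B E T) (x : Finset E) (μ : A → Fin T → ℝ) :
    Outcomes A T where
  soft := μ
  final a := M.ideal x a (Fin.last T)

end Outcomes

/-- The hard outcome inferred from a soft outcome. -/
def harden (M : GraphicalModel code A B E T) (a : A) (t : Fin T) (μ : ℝ) : ZMod 2 :=
  if M.density a t 1 μ ≤ M.density a t 0 μ then 0 else 1

/-- The hard outcomes; in the perfect final round, the outcome bits themselves. -/
def hard (M : GraphicalModel code A B E T) (m : Outcomes A T) (a : A) : Fin (T + 1) → ZMod 2 :=
  Fin.lastCases (m.final a) (fun t => M.harden a t (m.soft a t))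

/-- The syndrome: the sum of the hard outcomes of consecutive rounds (the outcome before the first
round being `0`). -/
def syndrome (M : GraphicalModel code A B E T) (m : Outcomes A T) (v : MVertex A T) : ZMod 2 :=
  Fin.cases (M.hard m v.1 0) (fun t => M.hard m v.1 t.succ + M.hard m v.1 t.castSucc) v.2

/-! ### The decoding graph -/

/-- Edges of the decoding graph: the faults (hard edges) and one soft vertical edge `(a, t)` for
each soft measurement. -/
abbrev DEdge (A E : Type*) (T : ℕ) : Type _ := E ⊕ (A × Fin T)

/-- Vertices of the decoding graph: the measurement vertices and the ghost vertex `none`, to which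
all boundary vertices are identified. -/
abbrev DVertex (A : Type*) (T : ℕ) : Type _ := Option (MVertex A T)

/-- The identification of the boundary vertices to the ghost vertex. -/
def ghost : Vertex A B T → DVertex A T := Sum.elim some (fun _ => none)

/-- The end points of an edge of the decoding graph, before the boundary vertices are
identified. The soft edge `(a, t)` connects `(a, t)` and `(a, t + 1)`. -/
def ends [DecidableEq A] [DecidableEq B] (M : GraphicalModel code A B E T) :
    DEdge A E T → Finset (Vertex A B T)
  | Sum.inl e => M.verts e
  | Sum.inr (a, t) => {Sum.inl (a, t.castSucc), Sum.inl (a, t.succ)}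

/-- The weight `-log (p / (1 - p))` of a hard edge, which is `∞` if `p = 0`. -/
def hardWeight (M : GraphicalModel code A B E T) (e : E) : ℝ≥0∞ :=
  if M.prob e = 0 then ∞ else ENNReal.ofReal (-Real.log (M.prob e / (1 - M.prob e)))

/-- The weight `-log L` of a soft edge, where `L` is the likelihood ratio of the two values of the
hard outcome. It is `∞` if `L = 0`. -/
def softWeight (M : GraphicalModel code A B E T) (μ : A → Fin T → ℝ) (a : A) (t : Fin T) : ℝ≥0∞ :=
  let i := M.harden a t (μ a t)
  if M.density a t (i + 1) (μ a t) = 0 then ∞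
  else ENNReal.ofReal (-Real.log (M.density a t (i + 1) (μ a t) / M.density a t i (μ a t)))

/-- The edge weights of the decoding graph, given the soft outcomes. -/
def weight (M : GraphicalModel code A B E T) (μ : A → Fin T → ℝ) : DEdge A E T → ℝ≥0∞
  | Sum.inl e => M.hardWeight e
  | Sum.inr (a, t) => M.softWeight μ a t

/-- The weighted minimum distance: the minimum weight of a fault set whose residual error is a
non-trivial logical error (`∞` if there is none). -/
def minDist (M : GraphicalModel code A B E T) : ℝ≥0∞ :=
  ⨅ x : Finset E, ⨅ _ : code.IsNontrivialLogical (M.resid x), ∑ e ∈ x, M.hardWeight e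

section Graph

variable [DecidableEq A] [DecidableEq B]

/-- The chain `x̃ = x + x_soft` of a fault set `x` and its soft flips, that is, the soft edges where
the hard outcome differs from the ideal outcome. -/
def withFlips [Fintype A] (M : GraphicalModel code A B E T) (x : Finset E) (μ : A → Fin T → ℝ) :
    Finset (DEdge A E T) :=
  x.disjSum (Finset.univ.filter fun v : A × Fin T =>
    M.harden v.1 v.2 (μ v.1 v.2) ≠ M.ideal x v.1 v.2.castSucc)

/-- The boundary of a 1-chain in the decoding graph. -/
def boundary (M : GraphicalModel code A B E T) (z : Finset (DEdge A E T)) (v : DVertex A T) :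
    ZMod 2 :=
  ∑ e ∈ z, ∑ u ∈ M.ends e, if ghost u = v then 1 else 0

/-- `M.IsWalk u v l`: the list `l` of edges is a walk from `u` to `v`. -/
inductive IsWalk (M : GraphicalModel code A B E T) :
    Vertex A B T → Vertex A B T → List (DEdge A E T) → Prop
  | nil (u : Vertex A B T) : IsWalk M u u []
  | cons {u v w : Vertex A B T} {e : DEdge A E T} {l : List (DEdge A E T)}
      (hu : u ∈ M.ends e) (hv : v ∈ M.ends e) (h : IsWalk M v w l) : IsWalk M u w (e :: l)

/-- The weighted distance between two vertices: the minimum length of a path along hard and soft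
edges. Paths may not jump between different boundary vertices. -/
def wdist (M : GraphicalModel code A B E T) (μ : A → Fin T → ℝ) (u v : Vertex A B T) : ℝ≥0∞ :=
  ⨅ l : List (DEdge A E T), ⨅ _ : M.IsWalk u v l, (l.map (M.weight μ)).sum

/-- The weighted diameter of a chain: the maximum distance between two incident vertices. -/
def wdiam (M : GraphicalModel code A B E T) (μ : A → Fin T → ℝ) (z : Finset (DEdge A E T)) :
    ℝ≥0∞ :=
  ⨆ u ∈ {u | ∃ e ∈ z, u ∈ M.ends e}, ⨆ v ∈ {v | ∃ e ∈ z, v ∈ M.ends e}, M.wdist μ u v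

/-- (C3), for the weights given by the soft outcomes `μ`: a chain with trivial syndrome and with
diameter less than the weighted minimum distance has a stabilizer as residual error. -/
def C3 (M : GraphicalModel code A B E T) (μ : A → Fin T → ℝ) : Prop :=
  ∀ z : Finset (DEdge A E T), (∀ v : MVertex A T, M.boundary z (some v) = 0) →
    M.wdiam μ z < M.minDist → M.resid z.toLeft ∈ code.stabilizers

/-! ### The split-edge graph -/

/-- Vertices of the split-edge graph: the vertices of the decoding graph, and one vertex in the
middle of each edge. -/
abbrev HVertex (A E : Type*) (T : ℕ) : Type _ := DVertex A T ⊕ DEdge A E T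

/-- Edges of the split-edge graph: an edge `e` of the decoding graph has one half for each of its
end points `u`; it connects `u` (the ghost vertex, if `u` is a boundary vertex) with the middle
of `e`. -/
abbrev Half (M : GraphicalModel code A B E T) : Type _ :=
  {h : DEdge A E T × Vertex A B T // h.2 ∈ M.ends h.1}

/-- The end point of a half edge which is a vertex of the decoding graph. -/
def Half.outer {M : GraphicalModel code A B E T} (h : M.Half) : HVertex A E T :=
  Sum.inl (ghost h.1.2)

/-- The end point of a half edge which is the middle of an edge of the decoding graph. -/
def Half.mid {M : GraphicalModel code A B E T} (h : M.Half) : HVertex A E T := Sum.inr h.1.1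

/-- The weight of a half edge. -/
def halfWeight (M : GraphicalModel code A B E T) (μ : A → Fin T → ℝ) (h : M.Half) : ℝ≥0∞ :=
  M.weight μ h.1.1 / 2

/-- Two vertices of the split-edge graph are joined by a fully grown edge. -/
def GrownAdj (M : GraphicalModel code A B E T) (μ : A → Fin T → ℝ) (γ : M.Half → ℝ≥0∞)
    (u v : HVertex A E T) : Prop :=
  ∃ h : M.Half, γ h = M.halfWeight μ h ∧
    (u = h.outer ∧ v = h.mid ∨ u = h.mid ∧ v = h.outer)

/-- The cluster of a vertex: the vertices which can be reached through fully grown edges. -/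
def cluster (M : GraphicalModel code A B E T) (μ : A → Fin T → ℝ) (γ : M.Half → ℝ≥0∞)
    (v : HVertex A E T) : Set (HVertex A E T) :=
  {u | Relation.ReflTransGen (M.GrownAdj μ γ) v u}

/-- `C` is an odd cluster: it does not contain the ghost vertex and it contains an odd number of
syndrome vertices. -/
def IsOddCluster (M : GraphicalModel code A B E T) (μ : A → Fin T → ℝ) (s : MVertex A T → ZMod 2)
    (γ : M.Half → ℝ≥0∞) (C : Set (HVertex A E T)) : Prop :=
  (∃ v, C = M.cluster μ γ v) ∧ Sum.inl none ∉ C ∧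
    Odd {v : MVertex A T | Sum.inl (some v) ∈ C ∧ s v = 1}.ncard

/-- The half edges `B(C)` which connect `C` with its complement. -/
def cut (M : GraphicalModel code A B E T) (C : Set (HVertex A E T)) : Set M.Half :=
  {h | ¬ (h.outer ∈ C ↔ h.mid ∈ C)}

/-- The perimeter of a cluster. -/
def perimeter (M : GraphicalModel code A B E T) (C : Set (HVertex A E T)) : ℕ := (M.cut C).ncard

/-- The growth increment `Γ_C`. -/
def increment (M : GraphicalModel code A B E T) (μ : A → Fin T → ℝ) (γ : M.Half → ℝ≥0∞)
    (C : Set (HVertex A E T)) : ℝ≥0∞ :=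
  ⨅ h ∈ M.cut C, (M.halfWeight μ h - γ h)

/-- The last growth step in which (a part of) the cluster `C` was grown, when `τ v` is the last
growth step of a cluster containing `v` (and `0` if there was none). -/
def lastGrown (τ : HVertex A E T → ℕ) (C : Set (HVertex A E T)) : ℕ := sSup (τ '' C)

/-- `C` may be selected for growth: it is an odd cluster of minimum perimeter and, among those, a
least recently grown one. -/
def IsSelected (M : GraphicalModel code A B E T) (μ : A → Fin T → ℝ) (s : MVertex A T → ZMod 2)
    (γ : M.Half → ℝ≥0∞) (τ : HVertex A E T → ℕ) (C : Set (HVertex A E T)) : Prop :=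
  M.IsOddCluster μ s γ C ∧ ∀ C', M.IsOddCluster μ s γ C' →
    M.perimeter C < M.perimeter C' ∨
      (M.perimeter C = M.perimeter C' ∧ lastGrown τ C ≤ lastGrown τ C')

/-- The edges of the decoding graph both of whose halves are fully grown. -/
def grownEdges (M : GraphicalModel code A B E T) (μ : A → Fin T → ℝ) (γ : M.Half → ℝ≥0∞) :
    Set (DEdge A E T) :=
  {e | ∀ h : M.Half, h.1.1 = e → γ h = M.halfWeight μ h}

/-- `F` is a spanning forest of the edge set `ε`: a maximal subset without cycles. -/
def IsSpanningForest (M : GraphicalModel code A B E T) (ε : Set (DEdge A E T))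
    (F : Finset (DEdge A E T)) : Prop :=
  Maximal (fun F' : Finset (DEdge A E T) =>
    (F' : Set (DEdge A E T)) ⊆ ε ∧ ∀ z ⊆ F', M.boundary z = 0 → z = ∅) F

/-- The edge `e` is a leaf of `F` with pendant vertex `v` (which is not the ghost vertex). -/
def IsLeaf (M : GraphicalModel code A B E T) (F : Finset (DEdge A E T)) (e : DEdge A E T)
    (v : MVertex A T) : Prop :=
  e ∈ F ∧ ∀ e' ∈ F, Sum.inl v ∈ M.ends e' ↔ e' = e

/-! ### The soft Union-Find decoder -/

/-- The states of the soft Union-Find decoder: during cluster growth, the growth states `γ`, the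
times `τ` of last growth and the number `n` of growth steps so far; during peeling, the remaining
forest `F`, the remaining syndrome `s` and the chain `y` constructed so far; and finally the
output, a fault set. -/
inductive DecoderState (M : GraphicalModel code A B E T) where
  | grow (γ : M.Half → ℝ≥0∞) (τ : HVertex A E T → ℕ) (n : ℕ) : DecoderState M
  | peel (F : Finset (DEdge A E T)) (s : MVertex A T → ZMod 2) (y : Finset (DEdge A E T)) :
      DecoderState M
  | done (x : Finset E) : DecoderState M

/-- The decoder starts with all growth states equal to `0`. -/
def start (M : GraphicalModel code A B E T) : M.DecoderState :=
  .grow (fun _ => 0) (fun _ => 0) 0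

open Classical in
/-- The steps of the soft Union-Find decoder on the input `m`. All choices that the algorithm leaves
open (remaining ties, the spanning forest and the order of the leaves) may be made arbitrarily. -/
inductive Step (M : GraphicalModel code A B E T) (m : Outcomes A T) :
    M.DecoderState → M.DecoderState → Prop
  /-- Select a cluster and grow all its boundary edges by `Γ_C`. -/
  | grow {γ : M.Half → ℝ≥0∞} {τ : HVertex A E T → ℕ} {n : ℕ} {C : Set (HVertex A E T)}
      (hC : M.IsSelected m.soft (M.syndrome m) γ τ C) :
      Step M m (.grow γ τ n)
        (.grow (fun h => if h ∈ M.cut C then γ h + M.increment m.soft γ C else γ h)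
          (fun v => if v ∈ C then n + 1 else τ v) (n + 1))
  /-- If there is no odd cluster, start the peeling decoder with a spanning forest of the grown
  edges. -/
  | startPeeling {γ : M.Half → ℝ≥0∞} {τ : HVertex A E T → ℕ} {n : ℕ} {F : Finset (DEdge A E T)}
      (heven : ∀ C, ¬ M.IsOddCluster m.soft (M.syndrome m) γ C)
      (hF : M.IsSpanningForest (M.grownEdges m.soft γ) F) :
      Step M m (.grow γ τ n) (.peel F (M.syndrome m) ∅)
  /-- Remove a leaf whose pendant vertex has trivial syndrome. -/
  | peelSkip {F : Finset (DEdge A E T)} {s : MVertex A T → ZMod 2} {y : Finset (DEdge A E T)}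
      {e : DEdge A E T} {v : MVertex A T} (he : M.IsLeaf F e v) (hs : s v = 0) :
      Step M m (.peel F s y) (.peel (F.erase e) s y)
  /-- Remove a leaf whose pendant vertex has non-trivial syndrome, add it to the correction and
  flip the syndrome at its end points. -/
  | peelTake {F : Finset (DEdge A E T)} {s : MVertex A T → ZMod 2} {y : Finset (DEdge A E T)}
      {e : DEdge A E T} {v : MVertex A T} (he : M.IsLeaf F e v) (hs : s v = 1) :
      Step M m (.peel F s y)
        (.peel (F.erase e) (fun u => s u + M.boundary {e} (some u)) (insert e y))
  /-- When the forest is exhausted, return the restriction of the correction to the fault graph. -/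
  | finish {s : MVertex A T → ZMod 2} {y : Finset (DEdge A E T)} :
      Step M m (.peel ∅ s y) (.done y.toLeft)

/-- The soft Union-Find decoder corrects the fault set `x` when the soft outcomes are `μ`: every
run of the decoder on the observed outcomes terminates, and it ends by returning a fault set `y`
such that the residual error after correction is a stabilizer. -/
def Corrects (M : GraphicalModel code A B E T) (x : Finset E) (μ : A → Fin T → ℝ) : Prop :=
  Acc (fun σ' σ => M.Step (M.outcomes x μ) σ σ') M.start ∧
    ∀ σ, Relation.ReflTransGen (M.Step (M.outcomes x μ)) M.start σ →
      (∀ σ', ¬ M.Step (M.outcomes x μ) σ σ') →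
        ∃ y : Finset E, σ = .done y ∧ M.resid x + M.resid y ∈ code.stabilizers

end Graph

end GraphicalModel

end SoftUF

end

open scoped ENNReal

noncomputable section

/-! Let `z` be the chain of faults and soft flips, whose boundary is the syndrome
(`boundary_withFlips`). Give each half edge the residual length `halfWeight - γ`, and let `S` be the
sum of all increments so far. Growing an odd cluster `C` by `Γ` has two effects.

Cost: `C` avoids the ghost vertex, so its vertices are at residual distance 0 from each other even
before boundary vertices are identified. A path gains nothing by crossing the cut of `C` more than
twice, so distances shrink by at most `2 * Γ` (`CostPath.exists_le_add`).

Gain: by parity the cut of `C` meets `z` (`IsOddCluster.exists_mem_cut`), so the residual length of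
`z` drops by at least `Γ`.

Hence a path of residual length `r` bounds the original distance by `2 * S + r`, and `S` plus the
residual length of `z` is at most the weight of `z`; this is `GrowthInvariant`. Only the oddness of
the selected cluster matters for it, not the rule of selection.

Once no cluster is odd, the grown edges carry a chain with the right syndrome, and peeling produces
such a chain `y`. In the cycle `z + y` the edges of `y` have residual length 0. So within a
connected component residual distances are at most the residual length of `z`
(`Conn.exists_costPath`), and original distances are at most twice the weight of `z`, which is less
than the minimum distance. (C3) applies to each component, and the residual errors add up
(`GrowthInvariant.resid_mem_stabilizers`).

The run is finite because each growth step completes a half edge and each peeling step removes an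
edge. It cannot get stuck early because a non-empty forest always has a leaf at a measurement vertex
(`exists_isLeaf`). -/

namespace SoftUF

/-! ### Path lengths in multigraphs: contracting a set, and bounding distances by total length -/

section CostPath

variable {W H : Type*} {o m : H → W} {ρ ρ' : H → ℝ≥0∞} {u v w : W} {r r' : ℝ≥0∞}

/-- The edge `h` of a multigraph with end points `o h` and `m h` joins `u` and `v`. -/
def Joins (o m : H → W) (h : H) (u v : W) : Prop := u = o h ∧ v = m h ∨ u = m h ∧ v = o h

theorem Joins.symm {h : H} (hj : Joins o m h u v) : Joins o m h v u := by
  unfold Joins at *; tauto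

/-- There is a path from `u` to `v` of length `r` for the edge lengths `ρ`. -/
inductive CostPath (o m : H → W) (ρ : H → ℝ≥0∞) : W → W → ℝ≥0∞ → Prop
  | refl (u : W) : CostPath o m ρ u u 0
  | step {u v w : W} {r : ℝ≥0∞} {h : H} (hj : Joins o m h u v) (p : CostPath o m ρ v w r) :
      CostPath o m ρ u w (ρ h + r)

theorem CostPath.trans (p : CostPath o m ρ u v r) (q : CostPath o m ρ v w r') :
    CostPath o m ρ u w (r + r') := by
  induction p with
  | refl u => simpa using q
  | step hj _ ih => rw [add_assoc]; exact .step hj (ih q)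

theorem CostPath.single {h : H} (hj : Joins o m h u v) : CostPath o m ρ u v (ρ h) := by
  simpa using CostPath.step (ρ := ρ) hj (.refl v)

theorem CostPath.symm (p : CostPath o m ρ u v r) : CostPath o m ρ v u r := by
  induction p with
  | refl u => exact .refl u
  | step hj _ ih => rw [add_comm]; exact ih.trans (.single hj.symm)

/-- Shortening the edges which leave `C` by `Γ` shortens the distance to `C` by at most `Γ`. -/
theorem CostPath.exists_of_mem {C : Set W} {Γ : ℝ≥0∞}
    (hin : ∀ h, (o h ∈ C ↔ m h ∈ C) → ρ h ≤ ρ' h) (hcut : ∀ h, ρ h ≤ ρ' h + Γ)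
    (p : CostPath o m ρ' u v r) (hv : v ∈ C) :
    ∃ c ∈ C, ∃ r' ≤ r + Γ, CostPath o m ρ u c r' := by
  induction p with
  | refl u => exact ⟨u, hv, 0, zero_le, .refl u⟩
  | @step u w v r h hj p ih =>
    by_cases hu : u ∈ C
    · exact ⟨u, hu, 0, zero_le, .refl u⟩
    by_cases hw : w ∈ C
    · refine ⟨w, hw, _, ?_, .single hj⟩
      calc ρ h ≤ ρ' h + Γ := hcut h
        _ ≤ ρ' h + r + Γ := by gcongr; exact le_self_add
    · obtain ⟨c, hc, r', hr', q⟩ := ih hv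
      refine ⟨c, hc, _, ?_, .step hj q⟩
      have : ρ h ≤ ρ' h := hin h (by rcases hj with ⟨rfl, rfl⟩ | ⟨rfl, rfl⟩ <;> tauto)
      calc ρ h + r' ≤ ρ' h + (r + Γ) := by gcongr
        _ = _ := by rw [add_assoc]

/-- Shortening the edges which leave a set `C` of vertices at distance `0` from each other by `Γ`
shortens distances by at most `2 * Γ`. -/
theorem CostPath.exists_le_add {C : Set W} {Γ : ℝ≥0∞}
    (hC : ∀ a ∈ C, ∀ b ∈ C, CostPath o m ρ a b 0)
    (hin : ∀ h, (o h ∈ C ↔ m h ∈ C) → ρ h ≤ ρ' h) (hcut : ∀ h, ρ h ≤ ρ' h + Γ)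
    (p : CostPath o m ρ' u v r) :
    ∃ r' ≤ r + 2 * Γ, CostPath o m ρ u v r' := by
  -- A path from `C` can be started at its last visit to `C`, at no cost, so only one cut edge is
  -- paid for. A general path pays for a second one when it first enters `C`.
  have key : ∀ {u v r}, CostPath o m ρ' u v r → u ∈ C → ∃ r' ≤ r + Γ, CostPath o m ρ u v r' := by
    intro u v r p hu
    obtain ⟨c, hc, r', hr', q⟩ := p.symm.exists_of_mem hin hcut hu
    exact ⟨0 + r', by simpa using hr', (hC u hu c hc).trans q.symm⟩
  induction p with
  | refl u => exact ⟨0, zero_le, .refl u⟩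
  | @step u w v r h hj p ih =>
    by_cases hu : u ∈ C
    · obtain ⟨r', hr', q⟩ := key (.step hj p) hu
      refine ⟨r', hr'.trans ?_, q⟩
      rw [two_mul]
      gcongr
      exact le_self_add
    by_cases hw : w ∈ C
    · obtain ⟨r', hr', q⟩ := key p hw
      refine ⟨_, ?_, .step hj q⟩
      calc ρ h + r' ≤ (ρ' h + Γ) + (r + Γ) := by gcongr; exact hcut h
        _ = _ := by ring
    · obtain ⟨r', hr', q⟩ := ih
      refine ⟨_, ?_, .step hj q⟩
      have : ρ h ≤ ρ' h := hin h (by rcases hj with ⟨rfl, rfl⟩ | ⟨rfl, rfl⟩ <;> tauto)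
      calc ρ h + r' ≤ ρ' h + (r + 2 * Γ) := by gcongr
        _ = _ := by rw [add_assoc]

/-- Two vertices are connected through edges in `Y`. -/
def Conn (o m : H → W) (Y : Set H) : W → W → Prop :=
  Relation.ReflTransGen fun u v => ∃ h ∈ Y, Joins o m h u v

theorem Conn.symm {Y : Set H} (p : Conn o m Y u v) : Conn o m Y v u :=
  by
  induction p with
  | refl => exact .refl
  | tail _ hbc ih =>
    obtain ⟨h, hY, hj⟩ := hbc
    exact .head ⟨h, hY, hj.symm⟩ ih

/-- A path never needs to traverse `h` more than once. -/
theorem Conn.split {Y : Set H} (h : H) (p : Conn o m Y u v) :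
    Conn o m (Y \ {h}) u v ∨
      ∃ a b, Joins o m h a b ∧ Conn o m (Y \ {h}) u a ∧ Conn o m (Y \ {h}) b v := by
  induction p with
  | refl => exact .inl .refl
  | @tail b c _ hbc ih =>
    obtain ⟨g, hg, hj⟩ := hbc
    by_cases hgh : g = h
    · subst hgh
      rcases ih with ih | ⟨a, a', hja, h1, h2⟩
      · exact .inr ⟨b, c, hj, ih, .refl⟩
      -- A second traversal of `h` ends either at `a'`, where the first one already led, or at `a`,
      -- which was reached without `h`.
      · have : c = a' ∨ c = a := by
          rcases hj with ⟨rfl, rfl⟩ | ⟨rfl, rfl⟩ <;> rcases hja with ⟨rfl, rfl⟩ | ⟨rfl, rfl⟩ <;> simp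
        rcases this with rfl | rfl
        · exact .inr ⟨a, c, hja, h1, .refl⟩
        · exact .inl h1
    · have hs : Conn o m (Y \ {h}) b c := .single ⟨g, ⟨hg, hgh⟩, hj⟩
      rcases ih with ih | ⟨a, a', hja, h1, h2⟩
      · exact .inl (ih.trans hs)
      · exact .inr ⟨a, a', hja, h1, h2.trans hs⟩

/-- A path stays in its component. This lets disjoint components be charged for disjoint sets of
edges. -/
theorem Conn.restrict {Y : Set H} (p : Conn o m Y u v) :
    Conn o m {g ∈ Y | Conn o m Y u (o g)} u v := by
  induction p with
  | refl => exact .refl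
  | @tail b c hub hbc ih =>
    obtain ⟨g, hg, hj⟩ := hbc
    refine ih.tail ⟨g, ⟨hg, ?_⟩, hj⟩
    rcases hj with ⟨rfl, rfl⟩ | ⟨rfl, rfl⟩
    · exact hub
    · exact hub.tail ⟨g, hg, .inr ⟨rfl, rfl⟩⟩

/-- The distance of vertices which are connected through edges in `Y` is at most the total length
of the edges in `Y`. -/
theorem Conn.exists_costPath (X : Finset H) {Y : Set H} (hY : ∀ h ∈ Y, h ∉ X → ρ h = 0)
    (p : Conn o m Y u v) : ∃ r ≤ ∑ h ∈ X, ρ h, CostPath o m ρ u v r := by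
  classical
  induction X using Finset.strongInduction generalizing Y u v with
  | H X ih =>
  rcases X.eq_empty_or_nonempty with rfl | ⟨h, hX⟩
  · refine ⟨0, zero_le, ?_⟩
    induction p with
    | refl => exact .refl _
    | tail _ hbc ih =>
      obtain ⟨g, hg, hj⟩ := hbc
      have := ih.trans (.single (ρ := ρ) hj)
      rwa [hY g hg (by simp), add_zero] at this
  have hss := Finset.erase_ssubset hX
  have hY' : ∀ g ∈ Y \ {h}, g ∉ X.erase h → ρ g = 0 := fun g hg hgX =>
    hY g hg.1 fun h' => hgX (Finset.mem_erase.2 ⟨hg.2, h'⟩)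
  have direct : Conn o m (Y \ {h}) u v → ∃ r ≤ ∑ h ∈ X, ρ h, CostPath o m ρ u v r := fun p => by
    obtain ⟨r, hr, q⟩ := ih _ hss hY' p
    exact ⟨r, hr.trans (Finset.sum_le_sum_of_subset hss.subset), q⟩
  rcases p.split h with p | ⟨a, b, hj, p, q⟩
  · exact direct p
  by_cases hab : Conn o m (Y \ {h}) a b
  · exact direct (p.trans (hab.trans q))
  -- Here removing `h` separates `a` from `b`. Each of the two remaining paths is charged only for
  -- edges of its own component, so no length is counted twice.
  have part : ∀ {c w}, Conn o m (Y \ {h}) c w →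
      ∃ r ≤ ∑ g ∈ (X.erase h).filter (fun g => Conn o m (Y \ {h}) c (o g)), ρ g,
        CostPath o m ρ c w r := fun p =>
    ih _ ((Finset.filter_subset _ _).trans_ssubset hss)
      (fun g hg hgX => hY' g hg.1 fun h' => hgX (Finset.mem_filter.2 ⟨h', hg.2⟩)) p.restrict
  obtain ⟨r₁, hr₁, q₁⟩ := part p.symm
  obtain ⟨r₂, hr₂, q₂⟩ := part q
  refine ⟨_, ?_, q₁.symm.trans (.step hj q₂)⟩
  have hd : Disjoint ((X.erase h).filter (fun g => Conn o m (Y \ {h}) a (o g)))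
      ((X.erase h).filter (fun g => Conn o m (Y \ {h}) b (o g))) := by
    rw [Finset.disjoint_filter]
    exact fun g _ h1 h2 => hab (h1.trans h2.symm)
  calc r₁ + (ρ h + r₂) = ρ h + (r₁ + r₂) := by ring
    _ ≤ ρ h + ∑ g ∈ X.erase h, ρ g := by
      gcongr
      refine (add_le_add hr₁ hr₂).trans ?_
      rw [← Finset.sum_union hd]
      exact Finset.sum_le_sum_of_subset
        (Finset.union_subset (Finset.filter_subset _ _) (Finset.filter_subset _ _))
    _ = _ := Finset.add_sum_erase _ _ hX

end CostPath

theorem sum_symmDiff_of_add_self {ι G : Type*} [DecidableEq ι] [AddCommGroup G]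
    (hG : ∀ g : G, g + g = 0) (s t : Finset ι) (f : ι → G) :
    ∑ i ∈ symmDiff s t, f i = ∑ i ∈ s, f i + ∑ i ∈ t, f i := by
  have hd : Disjoint (s \ t) (t \ s) := disjoint_sdiff_sdiff
  rw [symmDiff_def, Finset.sup_eq_union, Finset.sum_union hd,
    ← Finset.sum_inter_add_sum_sdiff s t f, ← Finset.sum_inter_add_sum_sdiff t s f,
    Finset.inter_comm t s]
  have := hG (∑ i ∈ s ∩ t, f i)
  generalize ∑ i ∈ s ∩ t, f i = a at *
  calc _ = (a + a) + (∑ i ∈ s \ t, f i + ∑ i ∈ t \ s, f i) := by rw [this, zero_add]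
    _ = _ := by abel

theorem zmod_two_fun_add_self {ι : Type*} (f : ι → ZMod 2) : f + f = 0 := by
  ext i; exact CharTwo.add_self_eq_zero (f i)

theorem Pauli.add_self {Q : Type*} (a : Pauli Q) : a + a = 0 := by
  ext q <;> exact CharTwo.add_self_eq_zero _

namespace GraphicalModel

@[simp] theorem ghost_eq_some {A B : Type*} {T : ℕ} {u : Vertex A B T} {v : MVertex A T} :
    ghost u = some v ↔ u = Sum.inl v := by
  rcases u with u | u <;> simp [ghost]

/-! ### Boundaries of chains modulo 2 and the syndrome -/

section Boundary

variable {Q P A B E : Type*} {T : ℕ} [Fintype Q] {code : PlaquetteCode Q P}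
  [DecidableEq A] [DecidableEq B] (M : GraphicalModel code A B E T)

variable {M} in
theorem card_ends (hC1 : M.C1) (e : DEdge A E T) : (M.ends e).card = 2 := by
  rcases e with e | ⟨a, t⟩
  · exact hC1 e
  · refine Finset.card_pair ?_
    simp [Fin.ext_iff]

theorem boundary_eq_sum (z : Finset (DEdge A E T)) : M.boundary z = ∑ e ∈ z, M.boundary {e} := by
  ext v; simp [boundary]

theorem boundary_empty : M.boundary (∅ : Finset (DEdge A E T)) = 0 := by
  ext v; simp [boundary]

theorem boundary_symmDiff [DecidableEq (DEdge A E T)] (s t : Finset (DEdge A E T)) :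
    M.boundary (symmDiff s t) = M.boundary s + M.boundary t := by
  rw [boundary_eq_sum, sum_symmDiff_of_add_self zmod_two_fun_add_self, ← boundary_eq_sum,
    ← boundary_eq_sum]

theorem boundary_erase [DecidableEq (DEdge A E T)] {z : Finset (DEdge A E T)} {e : DEdge A E T}
    (he : e ∈ z) : M.boundary (z.erase e) = M.boundary z + M.boundary {e} := by
  rw [M.boundary_eq_sum z, ← Finset.add_sum_erase _ _ he, ← boundary_eq_sum, add_right_comm,
    zmod_two_fun_add_self, zero_add]

theorem boundary_insert [DecidableEq (DEdge A E T)] {z : Finset (DEdge A E T)} {e : DEdge A E T}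
    (he : e ∉ z) : M.boundary (insert e z) = M.boundary z + M.boundary {e} := by
  rw [M.boundary_eq_sum (insert e z), Finset.sum_insert he, ← boundary_eq_sum, add_comm]

theorem boundary_some (z : Finset (DEdge A E T)) (v : MVertex A T) :
    M.boundary z (some v) = ∑ e ∈ z, if Sum.inl v ∈ M.ends e then 1 else 0 := by
  simp only [boundary, ghost_eq_some, Finset.sum_ite_eq']

variable {M} in
theorem boundary_single (e : DEdge A E T) (u v : Vertex A B T) (h : M.ends e = {u, v})
    (huv : u ≠ v) : M.boundary {e} = Pi.single (ghost u) 1 + Pi.single (ghost v) 1 := by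
  ext w
  simp only [boundary, Finset.sum_singleton, h, Finset.sum_pair huv, Pi.add_apply,
    Pi.single_apply, eq_comm]

theorem ideal_zero (x : Finset E) (a : A) :
    M.ideal x a 0 = ∑ e ∈ x, if Sum.inl (a, 0) ∈ M.verts e then 1 else 0 := by
  unfold ideal
  refine Finset.sum_congr rfl fun e _ => ?_
  have : Finset.Iic (0 : Fin (T + 1)) = {0} := by ext; simp
  rw [this, Finset.sum_singleton]

theorem ideal_succ (x : Finset E) (a : A) (t : Fin T) :
    M.ideal x a t.succ = M.ideal x a t.castSucc +
      ∑ e ∈ x, if Sum.inl (a, t.succ) ∈ M.verts e then 1 else 0 := by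
  unfold ideal
  rw [← Finset.sum_add_distrib]
  refine Finset.sum_congr rfl fun e _ => ?_
  have : Finset.Iic t.succ = insert t.succ (Finset.Iic t.castSucc) := by
    ext i
    simp only [Finset.mem_Iic, Finset.mem_insert, Fin.le_def, Fin.ext_iff, Fin.val_succ,
      Fin.val_castSucc]
    omega
  rw [this, Finset.sum_insert (by simp [Fin.le_def]), add_comm]

/-- The syndrome is the boundary of the chain of faults and soft flips. -/
theorem boundary_withFlips [Fintype A] (x : Finset E) (μ : A → Fin T → ℝ) (v : MVertex A T) :
    M.boundary (M.withFlips x μ) (some v) = M.syndrome (M.outcomes x μ) v := by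
  obtain ⟨a, k⟩ := v
  have hz : ∀ b c : ZMod 2, (if b ≠ c then (1 : ZMod 2) else 0) = b + c := by decide
  -- The indicator of a soft flip in round `t`. At round `k` the soft edges contribute the flips of
  -- rounds `k` and `k - 1`, and the faults contribute the change of the ideal outcome; the ideal
  -- outcomes cancel.
  set g : Fin T → ZMod 2 := fun t => M.harden a t (μ a t) + M.ideal x a t.castSucc with hg
  have hsoft : (∑ w : A × Fin T, if M.harden w.1 w.2 (μ w.1 w.2) ≠ M.ideal x w.1 w.2.castSucc then
      (if (Sum.inl (a, k) : Vertex A B T) ∈ M.ends (.inr w) then (1 : ZMod 2) else 0) else 0) =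
      ∑ t : Fin T, g t * ((if t.castSucc = k then 1 else 0) + if t.succ = k then 1 else 0) := by
    rw [Fintype.sum_prod_type, Finset.sum_eq_single a]
    · refine Finset.sum_congr rfl fun t _ => ?_
      have h1 : g t = if M.harden a t (μ a t) ≠ M.ideal x a t.castSucc then 1 else 0 :=
        (hz _ _).symm
      have h2 : ((if t.castSucc = k then 1 else 0) + if t.succ = k then 1 else 0 : ZMod 2) =
          if (Sum.inl (a, k) : Vertex A B T) ∈ M.ends (.inr (a, t)) then 1 else 0 := by
        have hne : ¬ (t.castSucc = k ∧ t.succ = k) := by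
          rintro ⟨rfl, h⟩; simp [Fin.ext_iff] at h
        simp only [ends, Finset.mem_insert, Finset.mem_singleton, Sum.inl.injEq, Prod.mk.injEq,
          true_and, eq_comm (a := k)]
        by_cases h1 : t.castSucc = k <;> by_cases h2 : t.succ = k <;> simp [h1, h2]
        exact hne ⟨h1, h2⟩
      rw [h1, h2]
      simp only [mul_ite, mul_one, mul_zero]
      split_ifs <;> rfl
    · intro b _ hb
      refine Finset.sum_eq_zero fun t _ => ?_
      simp [ends, hb.symm]
    · simp
  rw [boundary_some, withFlips, Finset.sum_disjSum, Finset.sum_filter, hsoft]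
  simp only [mul_add, Finset.sum_add_distrib, mul_ite, mul_one, mul_zero]
  have hhc : ∀ t : Fin T, M.hard (M.outcomes x μ) a t.castSucc = M.harden a t (μ a t) := by
    intro t; simp [hard, outcomes]
  -- No soft edge starts in the perfect round; there both sides vanish, since the hard outcome is
  -- the ideal one.
  have hcs : (∑ t : Fin T, if t.castSucc = k then g t else 0) =
      M.hard (M.outcomes x μ) a k + M.ideal x a k := by
    refine Fin.lastCases ?_ (fun t => ?_) k
    · have : ∀ t : Fin T, t.castSucc ≠ Fin.last T := fun t => (Fin.castSucc_lt_last t).ne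
      simp [this, hard, outcomes, CharTwo.add_self_eq_zero]
    · simp [hhc, hg]
  have hhd : (∑ e ∈ x, if (Sum.inl (a, k) : Vertex A B T) ∈ M.ends (.inl e) then (1 : ZMod 2)
      else 0) = ∑ e ∈ x, if Sum.inl (a, k) ∈ M.verts e then 1 else 0 := rfl
  rw [hcs, hhd]
  simp only [syndrome]
  clear hsoft hhd hcs
  refine Fin.cases ?_ (fun t => ?_) k
  · have : ∀ t : Fin T, t.succ ≠ 0 := Fin.succ_ne_zero
    simp only [this, if_false, Finset.sum_const_zero, add_zero, ideal_zero, Fin.cases_zero]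
    rw [add_left_comm, CharTwo.add_self_eq_zero, add_zero]
  · simp only [Fin.succ_inj, Finset.sum_ite_eq', Finset.mem_univ, if_true, hg, Fin.cases_succ,
      ideal_succ, hhc]
    generalize (∑ e ∈ x, if Sum.inl (a, t.succ) ∈ M.verts e then (1 : ZMod 2) else 0) = p
    generalize M.hard _ _ _ = q
    generalize M.harden _ _ _ = q'
    generalize M.ideal _ _ _ = r
    revert p q q' r
    decide

end Boundary

/-! ### Cluster growth -/

section Growth

variable {Q P A B E : Type*} {T : ℕ} [Fintype Q] {code : PlaquetteCode Q P}
  [DecidableEq A] [DecidableEq B] (M : GraphicalModel code A B E T)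

/-! ### Distances in the split-edge graph without identification of boundary vertices -/

/-- The end point of a half edge which is an end point of an edge. -/
def Half.end₀ {M : GraphicalModel code A B E T} (h : M.Half) : Vertex A B T ⊕ DEdge A E T :=
  Sum.inl h.1.2

/-- The end point of a half edge which is the middle of an edge. -/
def Half.end₁ {M : GraphicalModel code A B E T} (h : M.Half) : Vertex A B T ⊕ DEdge A E T :=
  Sum.inr h.1.1

/-- The identification of the boundary vertices in the split-edge graph. -/
def splitGhost : Vertex A B T ⊕ DEdge A E T → HVertex A E T := Sum.map ghost id

omit [DecidableEq A] [DecidableEq B] in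
theorem splitGhost_inj {a b : Vertex A B T ⊕ DEdge A E T} (hab : splitGhost a = splitGhost b)
    (ha : splitGhost a ≠ Sum.inl none) : a = b := by
  rcases a with (a | a) | a <;> rcases b with (b | b) | b <;> simp_all [splitGhost, ghost]

theorem wdist_self (μ : A → Fin T → ℝ) (u : Vertex A B T) : M.wdist μ u u = 0 := by
  refine le_antisymm ?_ zero_le
  exact (iInf₂_le (α := ℝ≥0∞) [] (IsWalk.nil u)).trans (by simp)

theorem wdist_le_add (μ : A → Fin T → ℝ) {e : DEdge A E T} {u v : Vertex A B T}
    (hu : u ∈ M.ends e) (hv : v ∈ M.ends e) (w : Vertex A B T) :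
    M.wdist μ u w ≤ M.weight μ e + M.wdist μ v w := by
  unfold wdist
  rw [ENNReal.add_iInf]
  refine le_iInf fun l => ?_
  by_cases hl : M.IsWalk v w l
  · simp only [hl, iInf_pos]
    exact (iInf₂_le (α := ℝ≥0∞) (e :: l) (IsWalk.cons hu hv hl)).trans (by simp)
  · simp [hl]

/-- A path may turn back in the middle of an edge. The induction therefore bounds, for a path
starting at the middle of `e`, the distance from every end point of `e`, at the price of another
half of the weight. -/
theorem wdist_le_of_costPath (μ : A → Fin T → ℝ) {u v : Vertex A B T} {r : ℝ≥0∞}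
    (p : CostPath Half.end₀ Half.end₁ (M.halfWeight μ) (Sum.inl u) (Sum.inl v) r) :
    M.wdist μ u v ≤ r := by
  suffices key : ∀ a b r, CostPath Half.end₀ Half.end₁ (M.halfWeight μ) a b r →
      b = Sum.inl v → (∀ u, a = Sum.inl u → M.wdist μ u v ≤ r) ∧
        ∀ e, a = Sum.inr e → ∀ u ∈ M.ends e, M.wdist μ u v ≤ M.weight μ e / 2 + r from
    (key _ _ _ p rfl).1 u rfl
  intro a b r p hb
  induction p with
  | refl a =>
    subst hb
    refine ⟨fun u hu => ?_, fun e he => by simp at he⟩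
    cases hu
    simp [wdist_self]
  | step hj p ih =>
    rename_i h
    obtain ⟨ih1, ih2⟩ := ih hb
    rcases hj with ⟨rfl, rfl⟩ | ⟨rfl, rfl⟩
    · refine ⟨fun u hu => ?_, fun e he => by simp [Half.end₀] at he⟩
      cases hu
      exact ih2 _ rfl _ h.2
    · refine ⟨fun u hu => by simp [Half.end₁] at hu, fun e he u hu => ?_⟩
      cases he
      refine (M.wdist_le_add μ hu h.2 v).trans ?_
      rw [halfWeight, ← add_assoc, ENNReal.add_halves]
      gcongr
      exact ih1 _ rfl

variable {M}

/-- Vertices of a cluster without the ghost vertex are joined by fully grown edges. -/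
theorem costPath_zero_of_mem_cluster {μ : A → Fin T → ℝ} {γ ρ : M.Half → ℝ≥0∞}
    (hρ : ∀ h, γ h = M.halfWeight μ h → ρ h = 0) {a b : Vertex A B T ⊕ DEdge A E T}
    (hb : splitGhost b ∈ M.cluster μ γ (splitGhost a))
    (hC : Sum.inl none ∉ M.cluster μ γ (splitGhost a)) :
    CostPath Half.end₀ Half.end₁ ρ a b 0 := by
  -- The walk is lifted step by step: it avoids the ghost vertex, and elsewhere the identification
  -- is injective, so consecutive edges still meet after lifting.
  suffices key : ∀ w, Relation.ReflTransGen (M.GrownAdj μ γ) (splitGhost a) w →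
      ∃ c, splitGhost c = w ∧ CostPath Half.end₀ Half.end₁ ρ a c 0 by
    obtain ⟨c, hc, p⟩ := key _ hb
    rwa [splitGhost_inj hc fun h => hC (by rw [← h, hc]; exact hb)] at p
  intro w hw
  induction hw with
  | refl => exact ⟨a, rfl, .refl a⟩
  | tail hw hadj ih =>
    obtain ⟨c, rfl, p⟩ := ih
    have hc : splitGhost c ≠ Sum.inl none := fun h => hC (by rw [← h]; exact hw)
    obtain ⟨h, hγ, ⟨h1, h2⟩ | ⟨h1, h2⟩⟩ := hadj
    · refine ⟨h.end₁, h2.symm, ?_⟩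
      have : c = h.end₀ := splitGhost_inj h1 hc
      have := p.trans (.single (ρ := ρ) (.inl ⟨this, rfl⟩ : Joins _ _ h _ _))
      rwa [hρ h hγ, zero_add] at this
    · refine ⟨h.end₀, h2.symm, ?_⟩
      have : c = h.end₁ := splitGhost_inj h1 hc
      have := p.trans (.single (ρ := ρ) (.inr ⟨this, rfl⟩ : Joins _ _ h _ _))
      rwa [hρ h hγ, zero_add] at this

theorem grownAdj_symm {μ : A → Fin T → ℝ} {γ : M.Half → ℝ≥0∞}
    {u v : HVertex A E T}
    (h : M.GrownAdj μ γ u v) : M.GrownAdj μ γ v u := by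
  obtain ⟨h, hγ, hj⟩ := h
  exact ⟨h, hγ, by tauto⟩

theorem mem_cluster_symm {μ : A → Fin T → ℝ} {γ : M.Half → ℝ≥0∞} {u v : HVertex A E T}
    (h : u ∈ M.cluster μ γ v) : v ∈ M.cluster μ γ u := by
  change Relation.ReflTransGen _ _ _ at h
  change Relation.ReflTransGen _ _ _
  induction h with
  | refl => exact .refl
  | tail _ h ih => exact .head (grownAdj_symm h) ih

theorem cluster_eq {μ : A → Fin T → ℝ} {γ : M.Half → ℝ≥0∞} {u v : HVertex A E T}
    (h : u ∈ M.cluster μ γ v) : M.cluster μ γ u = M.cluster μ γ v := by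
  ext w
  exact ⟨fun h' => Relation.ReflTransGen.trans h h',
    fun h' => Relation.ReflTransGen.trans (mem_cluster_symm h) h'⟩

theorem not_grown_of_mem_cut {μ : A → Fin T → ℝ} {γ : M.Half → ℝ≥0∞} {v : HVertex A E T}
    {h : M.Half} (hh : h ∈ M.cut (M.cluster μ γ v)) : γ h ≠ M.halfWeight μ h := by
  intro hγ
  refine hh ⟨fun h1 => ?_, fun h1 => ?_⟩
  · exact Relation.ReflTransGen.tail h1 ⟨h, hγ, .inl ⟨rfl, rfl⟩⟩
  · exact Relation.ReflTransGen.tail h1 ⟨h, hγ, .inr ⟨rfl, rfl⟩⟩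

theorem increment_le {μ : A → Fin T → ℝ} {γ : M.Half → ℝ≥0∞} {C : Set (HVertex A E T)} {h : M.Half}
    (hh : h ∈ M.cut C) : M.increment μ γ C ≤ M.halfWeight μ h - γ h := iInf₂_le h hh

/-- If there is an odd cluster, then one of them can be selected. -/
theorem IsOddCluster.exists_isSelected {μ : A → Fin T → ℝ} {s : MVertex A T → ZMod 2}
    {γ : M.Half → ℝ≥0∞} (τ : HVertex A E T → ℕ) {C : Set (HVertex A E T)}
    (hC : M.IsOddCluster μ s γ C) : ∃ C', M.IsSelected μ s γ τ C' := by
  obtain ⟨C', hC', hmin⟩ := WellFounded.has_min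
    (InvImage.wf (fun C => toLex (M.perimeter C, lastGrown τ C))
      (wellFounded_lt (α := ℕ ×ₗ ℕ))) {C | M.IsOddCluster μ s γ C} ⟨C, hC⟩
  refine ⟨C', hC', fun D hD => ?_⟩
  have := hmin D hD
  simp only [InvImage, not_lt, Prod.Lex.le_iff] at this
  exact this

variable [Fintype A] [Fintype B] [Fintype E]

/-- The boundary of an odd cluster meets each chain which explains the syndrome. -/
theorem IsOddCluster.exists_mem_cut (hC1 : M.C1) {μ : A → Fin T → ℝ} {s : MVertex A T → ZMod 2}
    {γ : M.Half → ℝ≥0∞} {C : Set (HVertex A E T)} (hC : M.IsOddCluster μ s γ C)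
    {z : Finset (DEdge A E T)} (hz : ∀ v, M.boundary z (some v) = s v) :
    ∃ h : M.Half, h.1.1 ∈ z ∧ h ∈ M.cut C := by
  classical
  by_contra! hcon
  obtain ⟨-, hnone, hodd⟩ := hC
  have h1 : ∑ v : MVertex A T, (if Sum.inl (some v) ∈ C then s v else 0) = 1 := by
    rw [← ZMod.natCast_eq_one_iff_odd] at hodd
    rw [← hodd, Set.ncard_eq_toFinset_card', Finset.card_eq_sum_ones, Nat.cast_sum]
    simp only [Set.toFinset_ofFinset, Finset.sum_filter]
    refine Finset.sum_congr rfl fun v _ => ?_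
    have : ∀ b : ZMod 2, b = if b = 1 then 1 else 0 := by decide
    by_cases h : Sum.inl (some v) ∈ C
    · simpa [h] using this (s v)
    · simp [h]
  -- If no half of an edge of `z` is cut, an edge has both end points in `C` when its middle is in
  -- `C`, and none otherwise. So each edge contributes an even number to the syndrome in `C`; the
  -- ghost vertex is not in `C` and loses nothing.
  have h2 : ∑ v : MVertex A T, (if Sum.inl (some v) ∈ C then s v else 0) = 0 := by
    calc _ = ∑ v : MVertex A T, ∑ e ∈ z, ∑ u ∈ M.ends e,
          (if Sum.inl (ghost u) ∈ C then if ghost u = some v then (1 : ZMod 2) else 0 else 0) := by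
          refine Finset.sum_congr rfl fun v _ => ?_
          rw [← hz, boundary]
          split_ifs with h
          · refine Finset.sum_congr rfl fun e _ => Finset.sum_congr rfl fun u _ => ?_
            by_cases hu : ghost u = some v
            · simp only [hu, h, if_true]
            · simp only [hu, if_false, ite_self]
          · symm
            refine Finset.sum_eq_zero fun e _ => Finset.sum_eq_zero fun u _ => ?_
            by_cases hu : ghost u = some v
            · simp only [hu, h, if_false]
            · simp only [hu, if_false, ite_self]
      _ = ∑ e ∈ z, ∑ u ∈ M.ends e, if Sum.inl (ghost u) ∈ C then (1 : ZMod 2) else 0 := by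
          rw [Finset.sum_comm]
          refine Finset.sum_congr rfl fun e _ => ?_
          rw [Finset.sum_comm]
          refine Finset.sum_congr rfl fun u _ => ?_
          split_ifs with h
          · rcases hg : (ghost u : DVertex A T) with _ | v
            · exact absurd (hg ▸ h) hnone
            · simp
          · simp
      _ = ∑ e ∈ z, ∑ u ∈ M.ends e, if Sum.inr e ∈ C then (1 : ZMod 2) else 0 := by
          refine Finset.sum_congr rfl fun e he => Finset.sum_congr rfl fun u hu => ?_
          have := not_not.1 (hcon ⟨(e, u), hu⟩ he)
          exact if_congr this rfl rfl
      _ = 0 := by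
          refine Finset.sum_eq_zero fun e _ => ?_
          rw [Finset.sum_const, card_ends hC1, two_nsmul, CharTwo.add_self_eq_zero]
  rw [h1] at h2
  exact one_ne_zero h2

/-- The halves of the edges in a chain. -/
def halves (M : GraphicalModel code A B E T) (z : Finset (DEdge A E T)) : Finset M.Half :=
  open Classical in Finset.univ.filter fun h => h.1.1 ∈ z

@[simp] theorem mem_halves {z : Finset (DEdge A E T)} {h : M.Half} :
    h ∈ M.halves z ↔ h.1.1 ∈ z := by simp [halves]

theorem sum_halves_le (hC1 : M.C1) (μ : A → Fin T → ℝ) (z : Finset (DEdge A E T)) :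
    ∑ h ∈ M.halves z, M.halfWeight μ h ≤ ∑ e ∈ z, M.weight μ e := by
  classical
  rw [← Finset.sum_fiberwise_of_maps_to (t := z) (g := fun h : M.Half => h.1.1)
    (fun h hh => mem_halves.1 hh)]
  refine Finset.sum_le_sum fun e _ => ?_
  calc ∑ h ∈ M.halves z with h.1.1 = e, M.halfWeight μ h
      = ∑ h ∈ M.halves z with h.1.1 = e, M.weight μ e / 2 := by
        refine Finset.sum_congr rfl fun h hh => ?_
        rw [halfWeight, (Finset.mem_filter.1 hh).2]
    _ ≤ 2 * (M.weight μ e / 2) := by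
        rw [Finset.sum_const, nsmul_eq_mul]
        gcongr
        have : ((M.halves z).filter (fun h => h.1.1 = e)).card ≤ (M.ends e).card := by
          refine Finset.card_le_card_of_injOn (fun h => h.1.2) ?_ ?_
          · intro h hh
            have := (Finset.mem_filter.1 hh).2
            exact this ▸ h.2
          · intro h hh h' hh' heq
            refine Subtype.ext (Prod.ext ?_ heq)
            rw [(Finset.mem_filter.1 hh).2, (Finset.mem_filter.1 hh').2]
        rw [card_ends hC1] at this
        exact_mod_cast this
    _ = _ := by rw [two_mul, ENNReal.add_halves]

/-- The invariant of cluster growth for the error chain `z`: if `S` is the total growth, then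
growing has shortened distances by at most `2 * S`, and at least `S` of the length of `z` has been
covered. -/
structure GrowthInvariant (M : GraphicalModel code A B E T) (μ : A → Fin T → ℝ)
    (z : Finset (DEdge A E T)) (γ : M.Half → ℝ≥0∞) (S : ℝ≥0∞) : Prop where
  le_weight : ∀ h, γ h ≤ M.halfWeight μ h
  wdist_le : ∀ u v r, CostPath Half.end₀ Half.end₁ (fun h => M.halfWeight μ h - γ h)
    (Sum.inl u) (Sum.inl v) r → M.wdist μ u v ≤ 2 * S + r
  covered : S + ∑ h ∈ M.halves z, (M.halfWeight μ h - γ h) ≤ ∑ e ∈ z, M.weight μ e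

theorem growthInvariant_zero (hC1 : M.C1) (μ : A → Fin T → ℝ) (z : Finset (DEdge A E T)) :
    M.GrowthInvariant μ z (fun _ => 0) 0 where
  le_weight _ := zero_le
  wdist_le u v r p := by
    simp only [tsub_zero] at p
    simpa using M.wdist_le_of_costPath μ p
  covered := by simpa using sum_halves_le hC1 μ z

open Classical in
/-- The growth states after growing `C`. -/
def grown (M : GraphicalModel code A B E T) (μ : A → Fin T → ℝ) (γ : M.Half → ℝ≥0∞)
    (C : Set (HVertex A E T)) : M.Half → ℝ≥0∞ :=
  fun h => if h ∈ M.cut C then γ h + M.increment μ γ C else γ h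

/-- Both uses of oddness meet here: the absence of the ghost vertex gives `C` residual diameter 0,
which bounds the loss of distance, and parity provides a half edge of `z` whose shrinking pays for
the increment of `S`. -/
theorem GrowthInvariant.grow (hC1 : M.C1) {μ : A → Fin T → ℝ} {z : Finset (DEdge A E T)}
    {s : MVertex A T → ZMod 2} (hz : ∀ v, M.boundary z (some v) = s v) {γ : M.Half → ℝ≥0∞}
    {S : ℝ≥0∞} (hI : M.GrowthInvariant μ z γ S) {C : Set (HVertex A E T)}
    (hC : M.IsOddCluster μ s γ C) :
    M.GrowthInvariant μ z (M.grown μ γ C) (S + M.increment μ γ C) := by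
  classical
  set Γ := M.increment μ γ C
  have hρcut : ∀ h ∈ M.cut C, M.halfWeight μ h - M.grown μ γ C h = M.halfWeight μ h - γ h - Γ :=
    fun h hh => by rw [grown, if_pos hh, tsub_add_eq_tsub_tsub]
  have hρin : ∀ h ∉ M.cut C, M.halfWeight μ h - M.grown μ γ C h = M.halfWeight μ h - γ h :=
    fun h hh => by rw [grown, if_neg hh]
  refine ⟨fun h => ?_, fun u v r p => ?_, ?_⟩
  · by_cases hh : h ∈ M.cut C
    · rw [grown, if_pos hh]
      calc γ h + Γ ≤ γ h + (M.halfWeight μ h - γ h) := by gcongr; exact increment_le hh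
        _ = _ := add_tsub_cancel_of_le (hI.le_weight h)
    · rw [grown, if_neg hh]; exact hI.le_weight h
  · have hconn : ∀ a ∈ splitGhost ⁻¹' C, ∀ b ∈ splitGhost ⁻¹' C,
        CostPath Half.end₀ Half.end₁ (fun h => M.halfWeight μ h - γ h) a b 0 := by
      intro a ha b hb
      obtain ⟨⟨v, rfl⟩, hnone, -⟩ := hC
      have heq := cluster_eq (M := M) ha
      refine costPath_zero_of_mem_cluster (γ := γ) (μ := μ) (fun h hh => by simp [hh]) ?_ ?_
      · rw [heq]; exact hb
      · rw [heq]; exact hnone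
    have hle : ∀ h, M.halfWeight μ h - γ h ≤ M.halfWeight μ h - M.grown μ γ C h + Γ := by
      intro h
      by_cases hh : h ∈ M.cut C
      · rw [hρcut h hh]; exact le_tsub_add
      · rw [hρin h hh]; exact le_self_add
    obtain ⟨r', hr', q⟩ := p.exists_le_add hconn (fun h hh => (hρin h (not_not.2 hh)).ge) hle
    calc M.wdist μ u v ≤ 2 * S + r' := hI.wdist_le _ _ _ q
      _ ≤ 2 * S + (r + 2 * Γ) := by gcongr
      _ = _ := by ring
  -- The half edge `h` of `z` loses exactly `Γ`; all others are no longer than before.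
  · obtain ⟨h, hhz, hh⟩ := hC.exists_mem_cut hC1 hz
    have hhz' : h ∈ M.halves z := mem_halves.2 hhz
    refine le_trans ?_ hI.covered
    rw [add_assoc, ← Finset.add_sum_erase _ _ hhz', ← Finset.add_sum_erase (M.halves z) _ hhz',
      ← add_assoc Γ, hρcut h hh, add_tsub_cancel_of_le (increment_le hh)]
    gcongr with g hg
    rw [grown]
    split_ifs
    exacts [le_self_add, le_rfl]

/-- A growth step fully grows another half edge. -/
theorem grown_ssubset (hC1 : M.C1) {μ : A → Fin T → ℝ} {z : Finset (DEdge A E T)}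
    {s : MVertex A T → ZMod 2} (hz : ∀ v, M.boundary z (some v) = s v) {γ : M.Half → ℝ≥0∞}
    (hγ : ∀ h, γ h ≤ M.halfWeight μ h) {C : Set (HVertex A E T)} (hC : M.IsOddCluster μ s γ C) :
    {h | M.grown μ γ C h ≠ M.halfWeight μ h} ⊂ {h | γ h ≠ M.halfWeight μ h} := by
  classical
  obtain ⟨h₀, -, hh₀⟩ := hC.exists_mem_cut hC1 hz
  -- The cut is finite and non-empty, so the increment is attained at some `h`, which becomes fully
  -- grown.
  obtain ⟨h, hh, hmin⟩ := Set.exists_min_image (M.cut C) (fun h => M.halfWeight μ h - γ h)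
    (Set.toFinite _) ⟨h₀, hh₀⟩
  have hinc : M.increment μ γ C = M.halfWeight μ h - γ h :=
    le_antisymm (increment_le hh) (le_iInf₂ hmin)
  have hcut : ∀ g ∈ M.cut C, γ g ≠ M.halfWeight μ g := by
    obtain ⟨⟨v, rfl⟩, -⟩ := hC
    exact fun g => not_grown_of_mem_cut
  refine Set.ssubset_iff_exists.2 ⟨fun g hg => ?_, h, hcut h hh, ?_⟩
  · by_cases hgc : g ∈ M.cut C
    · exact hcut g hgc
    · simpa [grown, hgc] using hg
  · simp [grown, hh, hinc, add_tsub_cancel_of_le (hγ h)]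

end Growth

/-! ### Spanning forests and the peeling decoder -/

section Peeling

variable {Q P A B E : Type*} {T : ℕ} [Fintype Q] {code : PlaquetteCode Q P}
  [DecidableEq A] [DecidableEq B] (M : GraphicalModel code A B E T)

/-- The boundaries of the chains in `ε`. -/
def boundaries (ε : Set (DEdge A E T)) : AddSubgroup (DVertex A T → ZMod 2) where
  carrier := {f | ∃ z : Finset (DEdge A E T), (z : Set (DEdge A E T)) ⊆ ε ∧ M.boundary z = f}
  zero_mem' := ⟨∅, by simp, M.boundary_empty⟩
  add_mem' := by
    classical
    rintro _ _ ⟨z, hz, rfl⟩ ⟨z', hz', rfl⟩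
    refine ⟨symmDiff z z', fun e he => ?_, M.boundary_symmDiff z z'⟩
    rcases Finset.mem_symmDiff.1 he with h | h
    exacts [hz h.1, hz' h.1]
  neg_mem' := by
    rintro _ ⟨z, hz, rfl⟩
    exact ⟨z, hz, eq_neg_of_add_eq_zero_left (zmod_two_fun_add_self _)⟩

variable {M}

theorem boundary_mem_boundaries {ε : Set (DEdge A E T)} {z : Finset (DEdge A E T)}
    (hz : (z : Set (DEdge A E T)) ⊆ ε) : M.boundary z ∈ M.boundaries ε := ⟨z, hz, rfl⟩

/-- By maximality, an edge of `ε` outside `F` closes a cycle with edges of `F`; the rest of that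
cycle has the same boundary as the edge. -/
theorem IsSpanningForest.boundaries_le {ε : Set (DEdge A E T)} {F : Finset (DEdge A E T)}
    (hF : M.IsSpanningForest ε F) : M.boundaries ε ≤ M.boundaries F := by
  classical
  rintro _ ⟨z, hz, rfl⟩
  rw [boundary_eq_sum]
  refine AddSubgroup.sum_mem _ fun e he => ?_
  by_cases heF : e ∈ F
  · exact boundary_mem_boundaries (by simpa using heF)
  have hnot : ¬ ((↑(insert e F) : Set (DEdge A E T)) ⊆ ε ∧
      ∀ z ⊆ insert e F, M.boundary z = 0 → z = ∅) := fun h =>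
    heF (hF.2 h (Finset.subset_insert e F) (Finset.mem_insert_self e F))
  have hsub : (↑(insert e F) : Set (DEdge A E T)) ⊆ ε := by
    rw [Finset.coe_insert, Set.insert_subset_iff]
    exact ⟨hz he, hF.1.1⟩
  simp only [hsub, true_and] at hnot
  push Not at hnot
  obtain ⟨c, hc, hc0, hne⟩ := hnot
  have hec : e ∈ c := by
    by_contra hec
    exact hne.ne_empty (hF.1.2 c ((Finset.subset_insert_iff_of_notMem hec).1 hc) hc0)
  refine ⟨c.erase e, ?_, ?_⟩
  · exact_mod_cast Finset.subset_insert_iff.1 hc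
  · rw [M.boundary_erase hec, hc0, zero_add]

/-- Vertices in the same cluster are the end points of a chain of grown edges. -/
theorem single_add_single_mem_boundaries (hC1 : M.C1) {μ : A → Fin T → ℝ} {γ : M.Half → ℝ≥0∞}
    {u v : DVertex A T} (h : Sum.inl v ∈ M.cluster μ γ (Sum.inl u)) :
    (Pi.single u 1 + Pi.single v 1 : DVertex A T → ZMod 2) ∈
      M.boundaries (M.grownEdges μ γ) := by
  set G := M.boundaries (M.grownEdges μ γ)
  -- At a middle vertex, the induction remembers a grown half through which it can be entered.
  -- Leaving through the same half returns to the old vertex; leaving through the other one shows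
  -- that the whole edge is grown.
  suffices key : ∀ w, Relation.ReflTransGen (M.GrownAdj μ γ) (Sum.inl u) w →
      (∀ v, w = Sum.inl v → (Pi.single u 1 + Pi.single v 1 : DVertex A T → ZMod 2) ∈ G) ∧
      ∀ e, w = Sum.inr e → ∃ h : M.Half, h.1.1 = e ∧ γ h = M.halfWeight μ h ∧
        (Pi.single u 1 + Pi.single (ghost h.1.2) 1 : DVertex A T → ZMod 2) ∈ G from
    (key _ h).1 v rfl
  intro w hw
  induction hw with
  | refl =>
    refine ⟨fun v hv => ?_, fun e he => by simp at he⟩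
    cases hv
    rw [zmod_two_fun_add_self]
    exact G.zero_mem
  | tail _ hadj ih =>
    obtain ⟨h, hγ, ⟨rfl, rfl⟩ | ⟨rfl, rfl⟩⟩ := hadj
    · refine ⟨fun v hv => by simp [Half.mid] at hv, fun e he => ?_⟩
      exact ⟨h, by simpa [Half.mid] using he, hγ, ih.1 _ rfl⟩
    · refine ⟨fun v hv => ?_, fun e he => by simp [Half.outer] at he⟩
      obtain ⟨h', hh', hγ', hG⟩ := ih.2 _ rfl
      obtain rfl : ghost h.1.2 = v := by simpa [Half.outer] using hv
      by_cases heq : h'.1.2 = h.1.2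
      · rwa [heq] at hG
      have hends : M.ends h.1.1 = {h'.1.2, h.1.2} := by
        symm
        refine Finset.eq_of_subset_of_card_le ?_ ?_
        · rw [Finset.insert_subset_iff, Finset.singleton_subset_iff]
          exact ⟨hh' ▸ h'.2, h.2⟩
        · rw [card_ends hC1, Finset.card_pair heq]
      have hmem : M.boundary {h.1.1} ∈ G := by
        refine boundary_mem_boundaries ?_
        simp only [Finset.coe_singleton, Set.singleton_subset_iff]
        intro g hg
        have hg2 : g.1.2 ∈ M.ends h.1.1 := hg ▸ g.2
        rw [hends, Finset.mem_insert, Finset.mem_singleton] at hg2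
        rcases hg2 with hg2 | hg2
        · rwa [show g = h' from Subtype.ext (Prod.ext (hg.trans hh'.symm) hg2)]
        · rwa [show g = h from Subtype.ext (Prod.ext hg hg2)]
      rw [boundary_single _ _ _ hends heq] at hmem
      have := G.add_mem hG hmem
      rwa [add_assoc, ← add_assoc (Pi.single (ghost h'.1.2) 1), zmod_two_fun_add_self,
        zero_add] at this

/-- If there is no odd cluster, then the grown edges contain a chain with the given syndrome. -/
theorem exists_boundary_eq [Fintype A] (hC1 : M.C1) {μ : A → Fin T → ℝ} {s : MVertex A T → ZMod 2}
    {γ : M.Half → ℝ≥0∞} (heven : ∀ C, ¬ M.IsOddCluster μ s γ C) :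
    ∃ f ∈ M.boundaries (M.grownEdges μ γ), ∀ v, f (some v) = s v := by
  classical
  -- Each syndrome vertex gets joined to a representative of its cluster, the ghost vertex whenever
  -- available. Any other representative is hit an even number of times, because its cluster is not
  -- odd.
  have hrep : ∀ C : Set (HVertex A E T), ∃ w : DVertex A T, (Sum.inl none ∈ C → w = none) ∧
      ∀ v : MVertex A T, Sum.inl (some v) ∈ C → Sum.inl w ∈ C := by
    intro C
    by_cases h : Sum.inl none ∈ C
    · exact ⟨none, fun _ => rfl, fun _ _ => h⟩
    by_cases h' : ∃ v : MVertex A T, Sum.inl (some v) ∈ C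
    · obtain ⟨v, hv⟩ := h'
      exact ⟨some v, fun h'' => absurd h'' h, fun _ _ => hv⟩
    · exact ⟨none, fun _ => rfl, fun v hv => absurd ⟨v, hv⟩ h'⟩
  choose rep hrep0 hrep1 using hrep
  set c : MVertex A T → Set (HVertex A E T) := fun v => M.cluster μ γ (Sum.inl (some v))
  have hself : ∀ v, Sum.inl (some v) ∈ c v := fun v => Relation.ReflTransGen.refl
  refine ⟨∑ v with s v = 1, (Pi.single (some v) 1 + Pi.single (rep (c v)) 1),
    AddSubgroup.sum_mem _ fun v _ =>
      single_add_single_mem_boundaries hC1 (hrep1 _ _ (hself v)), fun u => ?_⟩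
  have h1 : ∑ v with s v = 1, (if u = v then (1 : ZMod 2) else 0) = s u := by
    rw [Finset.sum_ite_eq]
    have : ∀ b : ZMod 2, (if b = 1 then (1 : ZMod 2) else 0) = b := by decide
    simpa using this (s u)
  have h2 : ∑ v with s v = 1, (if some u = rep (c v) then (1 : ZMod 2) else 0) = 0 := by
    by_cases hex : ∃ v₀, some u = rep (c v₀)
    · obtain ⟨v₀, hv₀⟩ := hex
      have hnone : Sum.inl none ∉ c v₀ := fun h => by simp [hrep0 _ h] at hv₀
      have hu : Sum.inl (some u) ∈ c v₀ := hv₀ ▸ hrep1 _ _ (hself v₀)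
      have hiff : ∀ v, some u = rep (c v) ↔ Sum.inl (some v) ∈ c v₀ := by
        refine fun v => ⟨fun h => ?_, fun h => ?_⟩
        · have hu' : Sum.inl (some u) ∈ c v := h ▸ hrep1 _ _ (hself v)
          change _ ∈ M.cluster μ γ _
          rw [← cluster_eq hu]
          exact mem_cluster_symm hu'
        · rw [hv₀]
          exact congrArg rep (cluster_eq h).symm
      have hev := heven (c v₀)
      rw [IsOddCluster] at hev
      have hev : ¬ Odd {v : MVertex A T | Sum.inl (some v) ∈ c v₀ ∧ s v = 1}.ncard := fun h =>
        hev ⟨⟨_, rfl⟩, hnone, h⟩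
      rw [Nat.not_odd_iff_even, ← ZMod.natCast_eq_zero_iff_even] at hev
      simp only [hiff]
      refine Eq.trans ?_ hev
      rw [Set.ncard_eq_toFinset_card', Finset.sum_boole, Finset.filter_filter]
      congr 2
      ext v
      simp [and_comm]
    · push Not at hex
      simp [hex]
  simp only [Finset.sum_apply, Pi.add_apply, Finset.sum_add_distrib, Pi.single_apply,
    Option.some.injEq]
  rw [h1, h2, add_zero]

/-- A chain with trivial syndrome is a cycle. -/
theorem boundary_eq_zero [Fintype A] (hC1 : M.C1) {z : Finset (DEdge A E T)}
    (hz : ∀ v, M.boundary z (some v) = 0) : M.boundary z = 0 := by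
  -- Every edge has two end points, so the value at the ghost vertex is determined by the others.
  have hsum : ∑ v, M.boundary z v = 0 := by
    simp only [boundary]
    rw [Finset.sum_comm]
    refine Finset.sum_eq_zero fun e _ => ?_
    rw [Finset.sum_comm]
    simp [card_ends hC1, CharTwo.two_eq_zero]
  rw [Fintype.sum_option] at hsum
  ext (_ | v)
  · simpa [hz] using hsum
  · exact hz v

/-- A non-empty forest has a leaf whose pendant vertex is not the ghost vertex. -/
theorem exists_isLeaf [Fintype A] (hC1 : M.C1) {F : Finset (DEdge A E T)} (hF : F.Nonempty)
    (hacyc : ∀ z ⊆ F, M.boundary z = 0 → z = ∅) : ∃ e v, M.IsLeaf F e v := by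
  classical
  -- Without a leaf, every touched measurement vertex has degree at least 2, so `V.card ≤ F.card`.
  -- Acyclicity makes the boundary map from subsets of `F` to functions on `V` injective, so the
  -- cardinalities agree and the map is bijective. Then every edge has both ends in `V`, all
  -- boundaries have even total, and a single vertex cannot be one.
  by_contra! hleaf
  set V : Finset (MVertex A T) := Finset.univ.filter fun v => ∃ e ∈ F, Sum.inl v ∈ M.ends e
  set inc : MVertex A T → DEdge A E T → Prop := fun v e => Sum.inl v ∈ M.ends e
  have hdeg : ∀ v ∈ V, 2 ≤ (F.bipartiteAbove inc v).card := by
    intro v hv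
    obtain ⟨e, heF, hve⟩ := (Finset.mem_filter.1 hv).2
    have := hleaf e v
    simp only [IsLeaf, not_and, not_forall] at this
    obtain ⟨e', he'F, he'⟩ := this heF
    have hne : e' ≠ e := by rintro rfl; simp [hve] at he'
    have hve' : Sum.inl v ∈ M.ends e' := by by_contra h; simp [h, hne] at he'
    refine Finset.one_lt_card.2 ⟨e, ?_, e', ?_, hne.symm⟩ <;>
      simp [Finset.mem_bipartiteAbove, inc, *]
  have hends : ∀ e ∈ F, (V.bipartiteBelow inc e).card ≤ 2 := by
    intro e _
    rw [← card_ends hC1 e]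
    refine Finset.card_le_card_of_injOn Sum.inl ?_ Sum.inl_injective.injOn
    intro v hv
    exact ((Finset.mem_bipartiteBelow inc).1 hv).2
  have hdc := Finset.sum_card_bipartiteAbove_eq_sum_card_bipartiteBelow (s := V) (t := F) inc
  have hge : V.card * 2 ≤ ∑ v ∈ V, (F.bipartiteAbove inc v).card := by
    simpa using Finset.card_nsmul_le_sum V _ 2 hdeg
  let Φ : F.powerset → (V → ZMod 2) := fun z v => M.boundary z.1 (some v.1)
  have hinj : Function.Injective Φ := by
    rintro ⟨z, hz⟩ ⟨z', hz'⟩ heq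
    rw [Finset.mem_powerset] at hz hz'
    have hsub : symmDiff z z' ⊆ F := fun e he => by
      rcases Finset.mem_symmDiff.1 he with h | h
      exacts [hz h.1, hz' h.1]
    have h0 : M.boundary (symmDiff z z') = 0 := by
      refine boundary_eq_zero hC1 fun v => ?_
      by_cases hv : v ∈ V
      · rw [boundary_symmDiff, Pi.add_apply, show M.boundary z (some v) = M.boundary z' (some v)
          from congrFun heq ⟨v, hv⟩, CharTwo.add_self_eq_zero]
      · rw [boundary_some]
        refine Finset.sum_eq_zero fun e he => if_neg fun hve => hv ?_
        exact Finset.mem_filter.2 ⟨Finset.mem_univ _, e, hsub he, hve⟩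
    exact Subtype.ext (symmDiff_eq_bot.1 (hacyc _ hsub h0))
  have hcard : F.card ≤ V.card := by
    have := Fintype.card_le_of_injective Φ hinj
    rw [Fintype.card_coe, Finset.card_powerset, Fintype.card_fun, ZMod.card, Fintype.card_coe] at this
    exact (Nat.pow_le_pow_iff_right one_lt_two).1 this
  have hle : ∑ e ∈ F, (V.bipartiteBelow inc e).card ≤ F.card * 2 := by
    simpa using Finset.sum_le_card_nsmul F _ 2 hends
  have hVF : V.card = F.card := by omega
  have hends2 : ∀ e ∈ F, (V.bipartiteBelow inc e).card = 2 := by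
    refine (Finset.sum_eq_sum_iff_of_le hends).1 ?_
    simp only [Finset.sum_const, smul_eq_mul]
    omega
  have hsurj : Function.Surjective Φ := by
    refine ((Fintype.bijective_iff_injective_and_card Φ).2 ⟨hinj, ?_⟩).2
    simp [hVF]
  obtain ⟨v₀, hv₀⟩ : V.Nonempty := by rw [← Finset.card_pos, hVF, Finset.card_pos]; exact hF
  obtain ⟨⟨z, hz⟩, hzv⟩ := hsurj (Pi.single ⟨v₀, hv₀⟩ 1)
  rw [Finset.mem_powerset] at hz
  have h1 : ∑ v : V, Φ ⟨z, Finset.mem_powerset.2 hz⟩ v = 1 := by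
    rw [hzv]; simp
  have h0 : ∑ v : V, Φ ⟨z, Finset.mem_powerset.2 hz⟩ v = 0 := by
    change ∑ v : V, M.boundary z (some v.1) = 0
    rw [Finset.sum_coe_sort V (fun v => M.boundary z (some v))]
    simp only [boundary_some]
    rw [Finset.sum_comm]
    refine Finset.sum_eq_zero fun e he => ?_
    have := hends2 e (hz he)
    rw [Finset.bipartiteBelow] at this
    rw [Finset.sum_boole, this]
    exact CharTwo.two_eq_zero
  exact one_ne_zero (h1.symm.trans h0)

/-- The invariant of the peeling decoder, for the grown edges `ε` and the syndrome `s₀`. -/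
structure PeelInvariant (M : GraphicalModel code A B E T) (ε : Set (DEdge A E T))
    (s₀ : MVertex A T → ZMod 2) (F : Finset (DEdge A E T)) (s : MVertex A T → ZMod 2)
    (y : Finset (DEdge A E T)) : Prop where
  forest_subset : (F : Set (DEdge A E T)) ⊆ ε
  acyclic : ∀ z ⊆ F, M.boundary z = 0 → z = ∅
  correction_subset : (y : Set (DEdge A E T)) ⊆ ε
  disjoint : Disjoint F y
  exists_chain : ∃ c ⊆ F, ∀ v, M.boundary c (some v) = s v
  boundary_add : ∀ v, M.boundary y (some v) + s v = s₀ v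

/-- Only `e` touches `v` within `F`, so the syndrome at the pendant vertex decides whether a chain
in `F` explaining it uses `e`. This makes each choice of the peeling decoder forced. -/
theorem IsLeaf.boundary_eq {F c : Finset (DEdge A E T)} {e : DEdge A E T} {v : MVertex A T}
    [Decidable (e ∈ c)] (he : M.IsLeaf F e v) (hc : c ⊆ F) :
    M.boundary c (some v) = if e ∈ c then 1 else 0 := by
  classical
  rw [boundary_some]
  calc _ = ∑ e' ∈ c, if e = e' then (1 : ZMod 2) else 0 :=
        Finset.sum_congr rfl fun e' he' => if_congr ((he.2 e' (hc he')).trans eq_comm) rfl rfl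
    _ = _ := by rw [Finset.sum_ite_eq]; congr

variable {ε : Set (DEdge A E T)} {s₀ s : MVertex A T → ZMod 2} {F y : Finset (DEdge A E T)}
  {e : DEdge A E T} {v : MVertex A T}

theorem PeelInvariant.skip [DecidableEq (DEdge A E T)] (hI : M.PeelInvariant ε s₀ F s y)
    (he : M.IsLeaf F e v) (hs : s v = 0) : M.PeelInvariant ε s₀ (F.erase e) s y where
  forest_subset := (Finset.coe_subset.2 (F.erase_subset e)).trans hI.forest_subset
  acyclic z hz := hI.acyclic z (hz.trans (F.erase_subset e))
  correction_subset := hI.correction_subset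
  disjoint := hI.disjoint.mono_left (F.erase_subset e)
  exists_chain := by
    obtain ⟨c, hc, hcs⟩ := hI.exists_chain
    refine ⟨c, Finset.subset_erase.2 ⟨hc, fun hec => ?_⟩, hcs⟩
    have := he.boundary_eq hc
    simp [hcs, hs, hec] at this
  boundary_add := hI.boundary_add

theorem PeelInvariant.take [DecidableEq (DEdge A E T)] (hI : M.PeelInvariant ε s₀ F s y)
    (he : M.IsLeaf F e v) (hs : s v = 1) :
    M.PeelInvariant ε s₀ (F.erase e) (fun u => s u + M.boundary {e} (some u)) (insert e y) where
  forest_subset := (Finset.coe_subset.2 (F.erase_subset e)).trans hI.forest_subset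
  acyclic z hz := hI.acyclic z (hz.trans (F.erase_subset e))
  correction_subset := by
    rw [Finset.coe_insert, Set.insert_subset_iff]
    exact ⟨hI.forest_subset he.1, hI.correction_subset⟩
  disjoint := by
    rw [Finset.disjoint_insert_right]
    exact ⟨Finset.notMem_erase e F, hI.disjoint.mono_left (F.erase_subset e)⟩
  exists_chain := by
    obtain ⟨c, hc, hcs⟩ := hI.exists_chain
    have hec : e ∈ c := by
      by_contra hec
      have := he.boundary_eq hc
      simp [hcs, hs, hec] at this
    refine ⟨c.erase e, Finset.erase_subset_erase e hc, fun u => ?_⟩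
    rw [M.boundary_erase hec, Pi.add_apply, hcs]
  boundary_add u := by
    have hey : e ∉ y := Finset.disjoint_left.1 hI.disjoint he.1
    rw [M.boundary_insert hey, Pi.add_apply, add_add_add_comm,
      CharTwo.add_self_eq_zero, add_zero, hI.boundary_add]

end Peeling

/-! ### Termination and correctness of the decoder -/

section Correctness

variable {Q P A B E : Type*} {T : ℕ} [Fintype Q] {code : PlaquetteCode Q P}
  [Fintype A] [Fintype B] [Fintype E] [DecidableEq A] [DecidableEq B]
  {M : GraphicalModel code A B E T}

omit [Fintype A] [Fintype B] [Fintype E] [DecidableEq A] [DecidableEq B] in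
theorem resid_toLeft (M : GraphicalModel code A B E T) (z : Finset (DEdge A E T)) :
    M.resid z.toLeft = ∑ e ∈ z, Sum.elim M.residual 0 e := by
  conv_rhs => rw [← Finset.toLeft_disjSum_toRight (u := z)]
  rw [Finset.sum_disjSum]
  simp [resid]

/-- If the total growth is bounded by the weight of a chain `z`, then a cycle which consists of `z`
and of grown edges has a stabilizer as residual error. -/
theorem GrowthInvariant.resid_mem_stabilizers [DecidableEq (DEdge A E T)] {μ : A → Fin T → ℝ}
    (hC3 : M.C3 μ) {z y : Finset (DEdge A E T)} {γ : M.Half → ℝ≥0∞} {S : ℝ≥0∞}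
    (hI : M.GrowthInvariant μ z γ S) (hz : 2 * ∑ e ∈ z, M.weight μ e < M.minDist)
    (hy : (y : Set (DEdge A E T)) ⊆ M.grownEdges μ γ)
    (hzy : ∀ v, M.boundary (symmDiff z y) (some v) = 0) :
    M.resid (symmDiff z y).toLeft ∈ code.stabilizers := by
  classical
  -- The cycle is split into components for connectivity through `Y`, with boundary vertices kept
  -- distinct, since (C3) measures diameters that way.
  set Y : Set M.Half := {h | h.1.1 ∈ z ∨ γ h = M.halfWeight μ h}
  let R : Setoid (DEdge A E T) :=
    { r := fun e e' => Conn Half.end₀ Half.end₁ Y (Sum.inr e) (Sum.inr e')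
      iseqv := ⟨fun _ => .refl, fun h => h.symm, fun h h' => h.trans h'⟩ }
  have hends : ∀ e ∈ symmDiff z y, ∀ u ∈ M.ends e,
      Conn Half.end₀ Half.end₁ Y (Sum.inl u) (Sum.inr e) := by
    intro e he u hu
    refine .single ⟨⟨(e, u), hu⟩, ?_, .inl ⟨rfl, rfl⟩⟩
    rcases Finset.mem_symmDiff.1 he with h | h
    · exact .inl h.1
    · exact .inr (hy h.1 _ rfl)
  rw [resid_toLeft, Finset.sum_partition R]
  refine AddSubgroup.sum_mem _ fun c _ => ?_
  rw [← resid_toLeft]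
  refine hC3 _ (fun v => ?_) (lt_of_le_of_lt ?_ hz)
  -- Edges of the cycle sharing a measurement vertex lie in one class, so at each such vertex a
  -- class has either the whole boundary of the cycle or none.
  · by_cases hv : ∃ e₀ ∈ symmDiff z y, Quotient.mk R e₀ = c ∧ Sum.inl v ∈ M.ends e₀
    · obtain ⟨e₀, he₀, rfl, hv₀⟩ := hv
      rw [← hzy v, boundary_some, boundary_some, Finset.sum_filter]
      refine Finset.sum_congr rfl fun e he => ?_
      split_ifs with h1 h2 h2 <;> try rfl
      exact absurd (Quotient.sound ((hends e he _ h2).symm.trans (hends e₀ he₀ _ hv₀))) h1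
    · rw [boundary_some]
      refine Finset.sum_eq_zero fun e he => if_neg fun hve => hv ?_
      rw [Finset.mem_filter] at he
      exact ⟨e, he.1, he.2, hve⟩
  · refine iSup₂_le fun u hu => iSup₂_le fun v hv => ?_
    obtain ⟨e, he, hu⟩ := hu
    obtain ⟨e', he', hv⟩ := hv
    rw [Finset.mem_filter] at he he'
    have hee' : Conn Half.end₀ Half.end₁ Y (Sum.inr e) (Sum.inr e') :=
      Quotient.exact (he.2.trans he'.2.symm)
    -- Half edges of `Y` outside `z` are fully grown and have residual length 0, also for infinite
    -- weight, as `∞ - ∞ = 0`.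
    obtain ⟨r, hr, p⟩ := Conn.exists_costPath (ρ := fun h => M.halfWeight μ h - γ h) (M.halves z)
      (fun h hh hhz => by
        rcases hh with hh | hh
        · exact absurd (mem_halves.2 hh) hhz
        · simp [hh])
      ((hends e he.1 u hu).trans (hee'.trans (hends e' he'.1 v hv).symm))
    calc M.wdist μ u v ≤ 2 * S + r := hI.wdist_le _ _ _ p
      _ ≤ 2 * S + 2 * ∑ h ∈ M.halves z, (M.halfWeight μ h - γ h) := by
        gcongr
        refine hr.trans ?_
        rw [two_mul]
        exact le_self_add
      _ ≤ 2 * ∑ e ∈ z, M.weight μ e := by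
        rw [← mul_add]
        gcongr
        exact hI.covered

omit [Fintype A] [Fintype B] [Fintype E] in
theorem acc_done (m : Outcomes A T) (y : Finset E) :
    Acc (fun σ' σ => M.Step m σ σ') (.done y) :=
  ⟨_, fun _ h => nomatch h⟩

omit [Fintype A] [Fintype B] [Fintype E] in
theorem acc_peel (m : Outcomes A T) (F : Finset (DEdge A E T)) (s : MVertex A T → ZMod 2)
    (y : Finset (DEdge A E T)) : Acc (fun σ' σ => M.Step m σ σ') (.peel F s y) := by
  classical
  induction hn : F.card using Nat.strong_induction_on generalizing F s y with
  | _ n ih =>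
    subst hn
    refine ⟨_, fun σ' h => ?_⟩
    cases h with
    | peelSkip he _ => exact ih _ (Finset.card_erase_lt_of_mem he.1) _ _ _ rfl
    | peelTake he _ => exact ih _ (Finset.card_erase_lt_of_mem he.1) _ _ _ rfl
    | finish => exact acc_done m _

/-- Cluster growth terminates. -/
theorem acc_grow (hC1 : M.C1) {m : Outcomes A T} {z : Finset (DEdge A E T)}
    (hz : ∀ v, M.boundary z (some v) = M.syndrome m v) {γ : M.Half → ℝ≥0∞} {S : ℝ≥0∞}
    (hI : M.GrowthInvariant m.soft z γ S) (τ : HVertex A E T → ℕ) (n : ℕ) :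
    Acc (fun σ' σ => M.Step m σ σ') (.grow γ τ n) := by
  -- The number of half edges that are not fully grown decreases in each growth step.
  induction hk : {h | γ h ≠ M.halfWeight m.soft h}.ncard using Nat.strong_induction_on
    generalizing γ S τ n with
  | _ k ih =>
    subst hk
    refine ⟨_, fun σ' h => ?_⟩
    cases h with
    | grow hC =>
      exact ih _ (Set.ncard_lt_ncard (grown_ssubset hC1 hz hI.le_weight hC.1))
        (hI.grow hC1 hz hC.1) _ _ rfl
    | startPeeling _ _ => exact acc_peel m _ _ _

/-- The invariant of the decoder for the fault set `x`. -/
def DecoderInvariant (M : GraphicalModel code A B E T) (m : Outcomes A T) (x : Finset E)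
    (z : Finset (DEdge A E T)) : M.DecoderState → Prop
  | .grow γ _ _ => ∃ S, M.GrowthInvariant m.soft z γ S
  | .peel F s y => ∃ γ S, M.GrowthInvariant m.soft z γ S ∧
      M.PeelInvariant (M.grownEdges m.soft γ) (M.syndrome m) F s y
  | .done y => M.resid x + M.resid y ∈ code.stabilizers

theorem DecoderInvariant.step (hC1 : M.C1) {m : Outcomes A T} (hC3 : M.C3 m.soft) {x : Finset E}
    {z : Finset (DEdge A E T)} (hzx : z.toLeft = x)
    (hz : ∀ v, M.boundary z (some v) = M.syndrome m v)
    (hzd : 2 * ∑ e ∈ z, M.weight m.soft e < M.minDist)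
    {σ σ' : M.DecoderState} (hσ : M.DecoderInvariant m x z σ) (h : M.Step m σ σ') :
    M.DecoderInvariant m x z σ' := by
  classical
  cases h with
  | grow hC =>
    obtain ⟨S, hI⟩ := hσ
    exact ⟨_, hI.grow hC1 hz hC.1⟩
  | @startPeeling γ τ n F heven hF =>
    obtain ⟨S, hI⟩ := hσ
    obtain ⟨f, hf, hfs⟩ := exists_boundary_eq hC1 heven
    obtain ⟨c, hc, rfl⟩ := hF.boundaries_le hf
    refine ⟨γ, S, hI, hF.1.1, hF.1.2, by simp, by simp, ⟨c, by exact_mod_cast hc, hfs⟩,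
      fun v => ?_⟩
    simp [boundary_empty]
  | peelSkip he hs =>
    obtain ⟨γ, S, hI, hP⟩ := hσ
    exact ⟨γ, S, hI, hP.skip he hs⟩
  | peelTake he hs =>
    obtain ⟨γ, S, hI, hP⟩ := hσ
    exact ⟨γ, S, hI, hP.take he hs⟩
  | @finish s y =>
    obtain ⟨γ, S, hI, hP⟩ := hσ
    -- The remaining syndrome is carried by the exhausted forest, hence zero, so `y` has the full
    -- syndrome and `z + y` is a cycle.
    obtain ⟨c, hc, hcs⟩ := hP.exists_chain
    rw [Finset.subset_empty] at hc
    subst hc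
    have hzy : ∀ v, M.boundary (symmDiff z y) (some v) = 0 := fun v => by
      have h1 := hP.boundary_add v
      rw [← hcs v, boundary_empty, Pi.zero_apply, add_zero] at h1
      rw [boundary_symmDiff, Pi.add_apply, hz, h1, CharTwo.add_self_eq_zero]
    have := hI.resid_mem_stabilizers hC3 hzd hP.correction_subset hzy
    rw [resid_toLeft, sum_symmDiff_of_add_self Pauli.add_self, ← resid_toLeft, ← resid_toLeft,
      hzx] at this
    exact this

/-- The decoder gets stuck only after it has returned a fault set. -/
theorem DecoderInvariant.exists_step (hC1 : M.C1) {m : Outcomes A T} {x : Finset E}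
    {z : Finset (DEdge A E T)} {σ : M.DecoderState} (hσ : M.DecoderInvariant m x z σ) :
    (∃ y, σ = .done y) ∨ ∃ σ', M.Step m σ σ' := by
  classical
  rcases σ with ⟨γ, τ, n⟩ | ⟨F, s, y⟩ | y
  · right
    by_cases hodd : ∃ C, M.IsOddCluster m.soft (M.syndrome m) γ C
    · obtain ⟨C, hC⟩ := hodd
      obtain ⟨C', hC'⟩ := hC.exists_isSelected τ
      exact ⟨_, .grow hC'⟩
    · push Not at hodd
      obtain ⟨F, hF⟩ := Set.Finite.exists_maximal (s := {F : Finset (DEdge A E T) |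
        (F : Set (DEdge A E T)) ⊆ M.grownEdges m.soft γ ∧
          ∀ z ⊆ F, M.boundary z = 0 → z = ∅}) (Set.toFinite _) ⟨∅, by simp⟩
      exact ⟨_, .startPeeling hodd hF⟩
  · right
    obtain ⟨γ, S, -, hP⟩ := hσ
    rcases F.eq_empty_or_nonempty with rfl | hF
    · exact ⟨_, .finish⟩
    · obtain ⟨e, v, he⟩ := exists_isLeaf hC1 hF hP.acyclic
      have : ∀ b : ZMod 2, b = 0 ∨ b = 1 := by decide
      rcases this (s v) with hs | hs
      · exact ⟨_, .peelSkip he hs⟩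
      · exact ⟨_, .peelTake he hs⟩
  · exact .inl ⟨y, rfl⟩

theorem DecoderInvariant.of_reflTransGen (hC1 : M.C1) {m : Outcomes A T} (hC3 : M.C3 m.soft)
    {x : Finset E} {z : Finset (DEdge A E T)} (hzx : z.toLeft = x)
    (hz : ∀ v, M.boundary z (some v) = M.syndrome m v)
    (hzd : 2 * ∑ e ∈ z, M.weight m.soft e < M.minDist) {σ : M.DecoderState}
    (h : Relation.ReflTransGen (M.Step m) M.start σ) : M.DecoderInvariant m x z σ := by
  induction h with
  | refl => exact ⟨0, growthInvariant_zero hC1 m.soft z⟩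
  | tail _ h ih => exact ih.step hC1 hC3 hzx hz hzd h

end Correctness

end GraphicalModel

end SoftUF

end

theorem mainTheorem3 {Q P A B E : Type*} [Fintype Q] [Fintype A] [Fintype B] [Fintype E]
    [DecidableEq A] [DecidableEq B] {T : ℕ} (code : SoftUF.PlaquetteCode Q P)
    (M : SoftUF.GraphicalModel code A B E T) (hC1 : M.C1) (hC2 : M.C2)
    (μ : A → Fin T → ℝ) (hC3 : M.C3 μ)
    (x : Finset E) (hx : ∑ e ∈ M.withFlips x μ, M.weight μ e < M.minDist / 2) :
    M.Corrects x μ := by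
  open SoftUF.GraphicalModel in
  have hz := M.boundary_withFlips x μ
  have hzd : 2 * ∑ e ∈ M.withFlips x μ, M.weight μ e < M.minDist := by
    rw [mul_comm]
    exact (ENNReal.lt_div_iff_mul_lt (.inl two_ne_zero) (.inl ENNReal.ofNat_ne_top)).1 hx
  refine ⟨acc_grow (m := M.outcomes x μ) hC1 hz (growthInvariant_zero hC1 μ _) _ _,
    fun σ hσ hstuck => ?_⟩
  have hI := DecoderInvariant.of_reflTransGen (m := M.outcomes x μ) (x := x) hC1 hC3
    (by simp [withFlips]) hz hzd hσ
  rcases hI.exists_step hC1 with ⟨y, rfl⟩ | ⟨σ', h⟩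
  · exact ⟨y, rfl, hI⟩
  · exact absurd h (hstuck σ')
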